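/- Let $(V_n,g)$ be a smooth $n$-dimensional manifold (without boundary) with a smooth metric $g$, i.e. a smooth symmetric non-degenerate 2-covariant tensor field, of Lorentzian or any other signature. Let $\nabla$ be its Levi-Civita connection, $R^{\alpha}{}_{\beta\gamma\delta} = \partial_\gamma \Gamma^\alpha_{\beta\delta} - \partial_\delta \Gamma^\alpha_{\beta\gamma} + \Gamma^\alpha_{\gamma\lambda}\Gamma^\lambda_{\beta\delta} - \Gamma^\alpha_{\delta\lambda}\Gamma^\lambda_{\beta\gamma}$ its curvature and $R_{\alpha\beta} = R^{\lambda}{}_{\alpha\lambda\beta}$ its Ricci tensor. Let $\boldsymbol\ell$ be a smooth null 1-form field, let $\vec\ell$ be the vector field obtained from it by raising the index with $g$, let $\vec a = \nabla_{\vec\ell}\,\vec\ell$ and $a^2 = g(\vec a,\vec a)$, and suppose that $\boldsymbol\ell$ is non-geodesic, i.e. that $a^2$ vanishes nowhere. Put $\bar R = R_{\mu\nu}\ell^\mu\ell^\nu$ and $$\gamma = g + \frac{\bar R}{a^2}\,\boldsymbol\ell\otimes\boldsymbol\ell .$$ Then: 1. $\gamma$ is again a smooth, symmetric, non-degenerate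 metric, and it is Lorentzian, of signature $(-,+,\dots,+)$, if $g$ is. 2. For every open set $U\subseteq V_n$ (in particular $U=V_n$) and every vector field $\vec\xi$, the following are equivalent: (i) $\vec\xi$ is a Kerr-Schild vector field of $g$ with respect to $\boldsymbol\ell$ on $U$: it is smooth on $U$, and $\mathcal L_{\vec\xi}\, g = 2h\,\boldsymbol\ell\otimes\boldsymbol\ell$ and $\mathcal L_{\vec\xi}\,\boldsymbol\ell = m\,\boldsymbol\ell$ on $U$ for some smooth functions $h$ and $m$ on $U$; (ii) $\vec\xi$ is a Killing vector field of $\gamma$ on $U$ (it is smooth on $U$ and $\mathcal L_{\vec\xi}\,\gamma = 0$ on $U$), and $\mathcal L_{\vec\xi}\,\boldsymbol\ell = m\,\boldsymbol\ell$ on $U$ for some smooth function $m$ on $U$. 3. $\gamma$ does not depend on the scaling of $\boldsymbol\ell$: for every smooth nowhere vanishing function $A$, the 1-form $A\boldsymbol\ell$ is again null and non-geodesic, and the tensor field $\gamma$ built from $A\boldsymbol\ell$ equals the one built from $\boldsymbol\ell$. -/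

import Mathlib

/-!
Pseudo-Riemannian geometry on a smooth manifold without boundary, modelled on a finite-dimensional
real vector space `E`. Tensor fields are sections of Mathlib's tangent bundle and of the bundles of
linear maps built on it. The local operations (Levi-Civita connection, Ricci tensor, Lie
derivatives) are computed at `x` in the preferred chart `extChartAt 𝓘(ℝ, E) x`, as for
Mathlib's `VectorField.mlieBracket`.
-/

open Bundle
open scoped Manifold ContDiff

noncomputable section

namespace KerrSchild

/-! ### Coordinate formulas on the model space -/

section Model

variable {E : Type*} [NormedAddCommGroup E] [NormedSpace ℝ E]

/-- The Christoffel symbols of the first kind of the metric coefficients `G`, as the covector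
`w ↦ ½ (∂_u G(v, w) + ∂_v G(u, w) - ∂_w G(u, v))`. -/
def christoffelFirst (G : E → E →L[ℝ] E →L[ℝ] ℝ) (y u v : E) : E →L[ℝ] ℝ :=
  (2⁻¹ : ℝ) • (fderiv ℝ G y u v + fderiv ℝ G y v u - ((fderiv ℝ G y).flip u).flip v)

theorem christoffelFirst_apply (G : E → E →L[ℝ] E →L[ℝ] ℝ) (y u v w : E) :
    christoffelFirst G y u v w
      = 2⁻¹ * (fderiv ℝ G y u v w + fderiv ℝ G y v u w - fderiv ℝ G y w u v) := rfl

/-- The Christoffel symbols (of the second kind) of the metric coefficients `G`,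
`Γ(u, v)^α = Γ^α_{βγ} u^β v^γ`: the index of `christoffelFirst` is raised with the inverse of
`G y`, seen as a map from vectors to covectors. -/
def christoffel (G : E → E →L[ℝ] E →L[ℝ] ℝ) (y u v : E) : E :=
  (G y).inverse (christoffelFirst G y u v)

/-- The curvature `R(u, v) w` of the metric coefficients `G`, with components
`R^α_{βγδ} w^β u^γ v^δ` for the sign convention
`R^α_{βγδ} = ∂_γ Γ^α_{βδ} - ∂_δ Γ^α_{βγ} + Γ^α_{γλ} Γ^λ_{βδ} - Γ^α_{δλ} Γ^λ_{βγ}`. -/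
def curvature (G : E → E →L[ℝ] E →L[ℝ] ℝ) (y u v w : E) : E :=
  fderiv ℝ (fun z ↦ christoffel G z v w) y u - fderiv ℝ (fun z ↦ christoffel G z u w) y v
    + christoffel G y u (christoffel G y v w) - christoffel G y v (christoffel G y u w)

/-- The Ricci tensor `R_{αβ} w^α v^β`, `R_{αβ} = R^λ_{αλβ}`, of the metric coefficients `G`:
the trace of `u ↦ R(u, v) w`, computed in a basis of `E`. -/
def ricciModel [FiniteDimensional ℝ E] (G : E → E →L[ℝ] E →L[ℝ] ℝ) (y w v : E) : ℝ :=
  ∑ i, (Module.finBasis ℝ E).coord i (curvature G y (Module.finBasis ℝ E i) v w)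

/-- Lie derivative of a 1-form `L` along `X`: `v ↦ (∂_X L)(v) + L(∂_v X)`. -/
def lieFormModel (X : E → E) (L : E → E →L[ℝ] ℝ) (y : E) : E →L[ℝ] ℝ :=
  fderiv ℝ L y (X y) + (L y) ∘L (fderiv ℝ X y)

/-- Lie derivative of a 2-covariant tensor field `G` along `X`:
`(u, v) ↦ (∂_X G)(u, v) + G(∂_u X, v) + G(u, ∂_v X)`. -/
def lieBilinModel (X : E → E) (G : E → E →L[ℝ] E →L[ℝ] ℝ) (y : E) : E →L[ℝ] E →L[ℝ] ℝ :=
  fderiv ℝ G y (X y) + (G y).bilinearComp (fderiv ℝ X y) (.id ℝ E)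
    + (G y).bilinearComp (.id ℝ E) (fderiv ℝ X y)

theorem lieBilinModel_apply (X : E → E) (G : E → E →L[ℝ] E →L[ℝ] ℝ) (y u v : E) :
    lieBilinModel X G y u v
      = fderiv ℝ G y (X y) u v + G y (fderiv ℝ X y u) v + G y u (fderiv ℝ X y v) := rfl

end Model

/-! ### Tensor fields on a manifold -/

variable {E : Type*} [NormedAddCommGroup E] [NormedSpace ℝ E]
  {M : Type*} [TopologicalSpace M] [ChartedSpace E M]

variable (E M) in
/-- Vector fields on `M` (no regularity). -/
abbrev VField := Π x : M, TangentSpace 𝓘(ℝ, E) x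

variable (E M) in
/-- 1-form fields on `M` (no regularity). -/
abbrev Form := Π x : M, TangentSpace 𝓘(ℝ, E) x →L[ℝ] ℝ

variable (E M) in
/-- 2-covariant tensor fields on `M` (no regularity). -/
abbrev Bilin := Π x : M, TangentSpace 𝓘(ℝ, E) x →L[ℝ] TangentSpace 𝓘(ℝ, E) x →L[ℝ] ℝ

/-- The vector field is `C^∞` on `U`. -/
def SmoothVFieldOn [IsManifold 𝓘(ℝ, E) ∞ M] (X : VField E M) (U : Set M) : Prop :=
  ContMDiffOn 𝓘(ℝ, E) (𝓘(ℝ, E).prod 𝓘(ℝ, E)) ∞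
    (fun x ↦ (TotalSpace.mk' E x (X x) : TangentBundle 𝓘(ℝ, E) M)) U

/-- The 1-form field is `C^∞`. -/
def SmoothForm [IsManifold 𝓘(ℝ, E) ∞ M] (ℓ : Form E M) : Prop :=
  ContMDiff 𝓘(ℝ, E) (𝓘(ℝ, E).prod 𝓘(ℝ, E →L[ℝ] ℝ)) ∞
    (fun x ↦ TotalSpace.mk' (E →L[ℝ] ℝ)
      (E := fun x : M ↦ TangentSpace 𝓘(ℝ, E) x →L[ℝ] Bundle.Trivial M ℝ x) x (ℓ x))

/-- The 2-covariant tensor field is `C^∞`. -/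
def SmoothBilin [IsManifold 𝓘(ℝ, E) ∞ M] (g : Bilin E M) : Prop :=
  ContMDiff 𝓘(ℝ, E) (𝓘(ℝ, E).prod 𝓘(ℝ, E →L[ℝ] E →L[ℝ] ℝ)) ∞
    (fun x ↦ TotalSpace.mk' (E →L[ℝ] E →L[ℝ] ℝ)
      (E := fun x : M ↦ TangentSpace 𝓘(ℝ, E) x →L[ℝ] TangentSpace 𝓘(ℝ, E) x →L[ℝ]
        Bundle.Trivial M ℝ x) x (g x))

/-- A smooth (pseudo-Riemannian) metric, of any signature: a smooth symmetric nondegenerate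
2-covariant tensor field. -/
structure IsMetric [IsManifold 𝓘(ℝ, E) ∞ M] (g : Bilin E M) : Prop where
  smooth : SmoothBilin g
  symm : ∀ x u v, g x u v = g x v u
  nondegenerate : ∀ x u, (∀ v, g x u v = 0) → u = 0

/-- Signature `(-, +, …, +)` at every point: there is a vector of negative square, and the form is
positive definite on its orthogonal complement. -/
def IsLorentzian (g : Bilin E M) : Prop :=
  ∀ x, ∃ t, g x t t < 0 ∧ ∀ v, g x t v = 0 → v ≠ 0 → 0 < g x v v

/-- Coordinate expression of a vector field in the chart around `x₀`. -/
def vfieldInChart (x₀ : M) (X : VField E M) : E → E :=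
  VectorField.mpullback 𝓘(ℝ, E) 𝓘(ℝ, E) (extChartAt 𝓘(ℝ, E) x₀).symm X

/-- Coordinate expression of a 1-form in the chart around `x₀`. -/
def formInChart (x₀ : M) (ℓ : Form E M) (y : E) : E →L[ℝ] ℝ :=
  (ℓ ((extChartAt 𝓘(ℝ, E) x₀).symm y)) ∘L
    (mfderiv 𝓘(ℝ, E) 𝓘(ℝ, E) (extChartAt 𝓘(ℝ, E) x₀).symm y)

/-- The bilinear form `(u, v) ↦ B(D u, D v)` on `F`. -/
def pullBilin {F V : Type*} [AddCommGroup F] [Module ℝ F] [TopologicalSpace F]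
    [AddCommGroup V] [Module ℝ V] [TopologicalSpace V] [IsTopologicalAddGroup V]
    [ContinuousConstSMul ℝ V] [IsTopologicalAddGroup F] [ContinuousConstSMul ℝ F]
    (B : V →L[ℝ] V →L[ℝ] ℝ) (D : F →L[ℝ] V) : F →L[ℝ] F →L[ℝ] ℝ :=
  ContinuousLinearMap.precomp ℝ D ∘L B ∘L D

/-- Coordinate expression of a 2-covariant tensor field in the chart around `x₀`. -/
def bilinInChart (x₀ : M) (g : Bilin E M) (y : E) : E →L[ℝ] E →L[ℝ] ℝ :=
  pullBilin (g ((extChartAt 𝓘(ℝ, E) x₀).symm y))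
    (mfderiv 𝓘(ℝ, E) 𝓘(ℝ, E) (extChartAt 𝓘(ℝ, E) x₀).symm y)

theorem bilinInChart_apply (x₀ : M) (g : Bilin E M) (y u v : E) :
    bilinInChart x₀ g y u v = g ((extChartAt 𝓘(ℝ, E) x₀).symm y)
      (mfderiv 𝓘(ℝ, E) 𝓘(ℝ, E) (extChartAt 𝓘(ℝ, E) x₀).symm y u)
      (mfderiv 𝓘(ℝ, E) 𝓘(ℝ, E) (extChartAt 𝓘(ℝ, E) x₀).symm y v) := rfl

/-- The differential at `x` of the chart around `x`. -/
def chartDeriv (x : M) : TangentSpace 𝓘(ℝ, E) x →L[ℝ] E :=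
  mfderiv 𝓘(ℝ, E) 𝓘(ℝ, E) (extChartAt 𝓘(ℝ, E) x) x

/-- The covariant derivative `∇_X Y` for the Levi-Civita connection of `g`:
`(∇_X Y)^α = X^β ∂_β Y^α + Γ^α_{βγ} X^β Y^γ`. -/
def covDeriv (g : Bilin E M) (X Y : VField E M) : VField E M := fun x ↦
  let y := extChartAt 𝓘(ℝ, E) x x
  (chartDeriv x).inverse
    (fderiv ℝ (vfieldInChart x Y) y (vfieldInChart x X y)
      + christoffel (bilinInChart x g) y (vfieldInChart x X y) (vfieldInChart x Y y))

/-- The Ricci tensor of `g`. -/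
def ricci [FiniteDimensional ℝ E] (g : Bilin E M) (x : M) (u v : TangentSpace 𝓘(ℝ, E) x) : ℝ :=
  ricciModel (bilinInChart x g) (extChartAt 𝓘(ℝ, E) x x) (chartDeriv x u) (chartDeriv x v)

/-- The Lie derivative of a 1-form along `X`. -/
def lieForm (X : VField E M) (ℓ : Form E M) : Form E M := fun x ↦
  (lieFormModel (vfieldInChart x X) (formInChart x ℓ) (extChartAt 𝓘(ℝ, E) x x)) ∘L chartDeriv x

/-- The Lie derivative of a 2-covariant tensor field along `X`. -/
def lieBilin (X : VField E M) (g : Bilin E M) : Bilin E M := fun x ↦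
  pullBilin (lieBilinModel (vfieldInChart x X) (bilinInChart x g) (extChartAt 𝓘(ℝ, E) x x))
    (chartDeriv x)

theorem lieBilin_apply (X : VField E M) (g : Bilin E M) (x : M) (u v : TangentSpace 𝓘(ℝ, E) x) :
    lieBilin X g x u v
      = lieBilinModel (vfieldInChart x X) (bilinInChart x g) (extChartAt 𝓘(ℝ, E) x x)
          (chartDeriv x u) (chartDeriv x v) := rfl

/-- The tensor square `ℓ ⊗ ℓ`. -/
def tensorSq (ℓ : Form E M) : Bilin E M := fun x ↦ (ℓ x).smulRight (ℓ x)

theorem tensorSq_apply (ℓ : Form E M) (x : M) (u v : TangentSpace 𝓘(ℝ, E) x) :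
    tensorSq ℓ x u v = ℓ x u * ℓ x v := by
  simp [tensorSq]

/-- The vector field obtained from the 1-form `ℓ` by raising the index with `g`, i.e.
`g x (sharp g ℓ x) = ℓ x` for a nondegenerate `g`. -/
def sharp (g : Bilin E M) (ℓ : Form E M) : VField E M := fun x ↦ (g x).inverse (ℓ x)

/-- The 1-form `ℓ` is null for `g`. -/
def IsNull (g : Bilin E M) (ℓ : Form E M) : Prop := ∀ x, g x (sharp g ℓ x) (sharp g ℓ x) = 0

/-- The acceleration `a = ∇_ℓ ℓ` of the vector field associated with `ℓ`. -/
def accel (g : Bilin E M) (ℓ : Form E M) : VField E M := covDeriv g (sharp g ℓ) (sharp g ℓ)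

/-- `a² = g(a, a)`. -/
def accelSq (g : Bilin E M) (ℓ : Form E M) (x : M) : ℝ := g x (accel g ℓ x) (accel g ℓ x)

/-- The 1-form `ℓ` is non-geodesic: `a²` vanishes nowhere. -/
def IsNonGeodesic (g : Bilin E M) (ℓ : Form E M) : Prop := ∀ x, accelSq g ℓ x ≠ 0

/-- `R̄ = R_{μν} ℓ^μ ℓ^ν`. -/
def ricciBar [FiniteDimensional ℝ E] (g : Bilin E M) (ℓ : Form E M) (x : M) : ℝ := ricci g x (sharp g ℓ x) (sharp g ℓ x)

/-- `γ = g + (R̄ / a²) ℓ ⊗ ℓ`. -/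
def gammaMetric [FiniteDimensional ℝ E] (g : Bilin E M) (ℓ : Form E M) : Bilin E M := fun x ↦
  g x + (ricciBar g ℓ x / accelSq g ℓ x) • tensorSq ℓ x

/-- `L_X ℓ = m ℓ` on `U` for some smooth function `m`. -/
def PreservesDirectionOn (ℓ : Form E M) (X : VField E M) (U : Set M) : Prop :=
  ∃ m : M → ℝ, ContMDiffOn 𝓘(ℝ, E) 𝓘(ℝ, ℝ) ∞ m U ∧ ∀ x ∈ U, lieForm X ℓ x = m x • ℓ x

/-- `X` is, on `U`, a (smooth) Kerr-Schild vector field of `g` with respect to `ℓ`: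
`L_X g = 2 h ℓ ⊗ ℓ` and `L_X ℓ = m ℓ` for some smooth functions `h` and `m`. -/
def IsKerrSchildOn [IsManifold 𝓘(ℝ, E) ∞ M] (g : Bilin E M) (ℓ : Form E M)
    (X : VField E M) (U : Set M) : Prop :=
  SmoothVFieldOn X U ∧
  (∃ h : M → ℝ, ContMDiffOn 𝓘(ℝ, E) 𝓘(ℝ, ℝ) ∞ h U ∧
    ∀ x ∈ U, lieBilin X g x = (2 * h x) • tensorSq ℓ x) ∧
  PreservesDirectionOn ℓ X U

/-- `X` is, on `U`, a (smooth) Killing vector field of `g`. -/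
def IsKillingOn [IsManifold 𝓘(ℝ, E) ∞ M] (g : Bilin E M) (X : VField E M) (U : Set M) : Prop :=
  SmoothVFieldOn X U ∧ ∀ x ∈ U, lieBilin X g x = 0

end KerrSchild

end

/-! Write `S` for the vector field of `ℓ`, `A = ∇S`, `a = A S`, `f = R̄ / a²`. Everything rests on
one identity along a Kerr-Schild field `X`: `X(R̄) = 2 m R̄ - 2 h a²`, together with `X(a²) = 4 m
a²`. They give `X(f) = -2 m f - 2 h`, so that `L_X γ = (2 h + X(f) + 2 m f) ℓ ⊗ ℓ = 0`. Conversely,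
if `L_X γ = 0` and `L_X ℓ = m ℓ`, the Leibniz rule alone forces `L_X g = 2 h ℓ ⊗ ℓ` with `h = -(X(f)
/ 2 + m f)`.

To obtain the first identity, the Ricci tensor is not differentiated as a whole. Instead `Ric(S, S)
= div a - S(div S) - tr(A²)` (`bochner`, `ricciModel_eq_bochner`), which needs only traces of `∇S`
and `∇a`. Nullity gives `[X, S] = m S` (`bracket_sharp`), and `L_X Γ` follows from `L_X g`
(`bilin_lieConn`, `bilin_lieConn_eq`). Since `ℓ(S) = 0` and `ℓ(A u) = 0`, almost all terms in `h`
vanish or cancel: `div S` and `div a` carry none, and `tr(A²)` contributes `2 h a²`. The derivatives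
of `m` cancel in the sum (`fderiv_bochner`).

The definitions use the preferred chart at each point, whereas differentiating needs one fixed chart
on a neighbourhood. The naturality lemmas (`related_christoffelL`, `related_bochner`,
`related_lieBilinModel`, `related_lieFormModel`) applied to transition maps bridge this.

The signature is preserved because `v ↦ v - (f / 2) ℓ(v) S` carries `g` to `γ`. Under `ℓ ↦ A ℓ` with
a function `A`, `R̄` scales by `A²`, `a²` by `A⁴` and `ℓ ⊗ ℓ` by `A²`, so `γ` is unchanged. -/

namespace KerrSchild

section Model

variable {E : Type*} [NormedAddCommGroup E] [NormedSpace ℝ E]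

/-! ### Shortcut instances for spaces of bilinear maps -/

noncomputable instance formNormedAddCommGroup {E : Type*} [NormedAddCommGroup E]
    [NormedSpace ℝ E] : NormedAddCommGroup (E →L[ℝ] ℝ) :=
  ContinuousLinearMap.toNormedAddCommGroup

noncomputable instance formNormedSpace {E : Type*} [NormedAddCommGroup E] [NormedSpace ℝ E] :
    NormedSpace ℝ (E →L[ℝ] ℝ) :=
  ContinuousLinearMap.toNormedSpace

noncomputable instance bilinNormedAddCommGroup {E : Type*} [NormedAddCommGroup E]
    [NormedSpace ℝ E] : NormedAddCommGroup (E →L[ℝ] E →L[ℝ] ℝ) :=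
  ContinuousLinearMap.toNormedAddCommGroup

noncomputable instance bilinNormedSpace {E : Type*} [NormedAddCommGroup E] [NormedSpace ℝ E] :
    NormedSpace ℝ (E →L[ℝ] E →L[ℝ] ℝ) :=
  ContinuousLinearMap.toNormedSpace

/-! ### Differentiation of bilinear expressions -/

theorem fderiv_apply_vec {F H : Type*} [NormedAddCommGroup F] [NormedSpace ℝ F]
    [NormedAddCommGroup H] [NormedSpace ℝ H] {A : E → F →L[ℝ] H} {Y : E → F} {y : E}
    (hA : DifferentiableAt ℝ A y) (hY : DifferentiableAt ℝ Y y) (u : E) :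
    fderiv ℝ (fun z ↦ A z (Y z)) y u = fderiv ℝ A y u (Y y) + A y (fderiv ℝ Y y u) := by
  rw [fderiv_clm_apply hA hY]
  simp [add_comm]

theorem fderiv_apply_const {F H : Type*} [NormedAddCommGroup F] [NormedSpace ℝ F]
    [NormedAddCommGroup H] [NormedSpace ℝ H] {A : E → F →L[ℝ] H} {y : E}
    (hA : DifferentiableAt ℝ A y) (v : F) (u : E) :
    fderiv ℝ (fun z ↦ A z v) y u = fderiv ℝ A y u v := by
  rw [fderiv_apply_vec hA (differentiableAt_const v)]
  simp

theorem fderiv_bilin_apply {B : E → E →L[ℝ] E →L[ℝ] ℝ} {Y Z : E → E} {y : E}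
    (hB : DifferentiableAt ℝ B y) (hY : DifferentiableAt ℝ Y y) (hZ : DifferentiableAt ℝ Z y)
    (u : E) :
    fderiv ℝ (fun z ↦ B z (Y z) (Z z)) y u
      = fderiv ℝ B y u (Y y) (Z y) + B y (fderiv ℝ Y y u) (Z y)
        + B y (Y y) (fderiv ℝ Z y u) := by
  rw [fderiv_apply_vec (hB.clm_apply hY) hZ, fderiv_apply_vec hB hY]
  simp

theorem _root_.ContDiffAt.differentiableAt_of_top {F H : Type*} [NormedAddCommGroup F]
    [NormedSpace ℝ F] [NormedAddCommGroup H] [NormedSpace ℝ H] {f : F → H} {x : F}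
    (hf : ContDiffAt ℝ ∞ f x) : DifferentiableAt ℝ f x :=
  hf.differentiableAt (by simp)

theorem _root_.ContDiffAt.fderiv_of_top {F H : Type*} [NormedAddCommGroup F]
    [NormedSpace ℝ F] [NormedAddCommGroup H] [NormedSpace ℝ H] {f : F → H} {x : F}
    (hf : ContDiffAt ℝ ∞ f x) : ContDiffAt ℝ ∞ (fderiv ℝ f) x :=
  hf.fderiv_right (by simp)

theorem _root_.ContDiffAt.fderiv_fderiv_symm {F H : Type*} [NormedAddCommGroup F]
    [NormedSpace ℝ F] [NormedAddCommGroup H] [NormedSpace ℝ H] {f : F → H} {x : F}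
    (hf : ContDiffAt ℝ ∞ f x) (u v : F) :
    fderiv ℝ (fderiv ℝ f) x u v = fderiv ℝ (fderiv ℝ f) x v u :=
  (hf.isSymmSndFDerivAt (by simpa using WithTop.coe_le_coe.2 (le_top (a := (2 : ℕ∞))))).eq u v

/-! ### Affine connections on the model space -/

/-- The covariant derivative `u ↦ ∇_u Y = ∂_u Y + Γ(u, Y)` as an endomorphism field. -/
noncomputable def nab (Γ : E → E →L[ℝ] E →L[ℝ] E) (Y : E → E) (y : E) : E →L[ℝ] E :=
  fderiv ℝ Y y + (Γ y).flip (Y y)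

theorem nab_apply (Γ : E → E →L[ℝ] E →L[ℝ] E) (Y : E → E) (y u : E) :
    nab Γ Y y u = fderiv ℝ Y y u + Γ y u (Y y) := by simp [nab]

theorem contDiffAt_nab {Γ : E → E →L[ℝ] E →L[ℝ] E} {Y : E → E} {y : E}
    (hΓ : ContDiffAt ℝ ∞ Γ y) (hY : ContDiffAt ℝ ∞ Y y) : ContDiffAt ℝ ∞ (nab Γ Y) y := by
  refine hY.fderiv_of_top.add (ContDiffAt.clm_apply ?_ hY)
  exact (ContinuousLinearMap.flipₗᵢ ℝ E E E).contDiff.contDiffAt.comp y hΓ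

theorem fderiv_nab {Γ : E → E →L[ℝ] E →L[ℝ] E} {Y : E → E} {y : E}
    (hΓ : ContDiffAt ℝ ∞ Γ y) (hY : ContDiffAt ℝ ∞ Y y) (w u : E) :
    fderiv ℝ (nab Γ Y) y w u = fderiv ℝ (fderiv ℝ Y) y w u + fderiv ℝ Γ y w u (Y y)
      + Γ y u (fderiv ℝ Y y w) := by
  rw [← fderiv_apply_const (contDiffAt_nab hΓ hY).differentiableAt_of_top]
  simp only [nab_apply]
  have h1 : DifferentiableAt ℝ (fun z ↦ fderiv ℝ Y z u) y :=
    hY.fderiv_of_top.differentiableAt_of_top.clm_apply (differentiableAt_const u)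
  have h2 : DifferentiableAt ℝ (fun z ↦ Γ z u) y :=
    hΓ.differentiableAt_of_top.clm_apply (differentiableAt_const u)
  have h3 : DifferentiableAt ℝ (fun z ↦ Γ z u (Y z)) y :=
    h2.clm_apply hY.differentiableAt_of_top
  rw [fderiv_fun_add h1 h3, add_apply,
    fderiv_apply_const hY.fderiv_of_top.differentiableAt_of_top,
    fderiv_apply_vec h2 hY.differentiableAt_of_top,
    fderiv_apply_const hΓ.differentiableAt_of_top]
  abel

/-- The acceleration `∇_Y Y`. -/
noncomputable def selfAccel (Γ : E → E →L[ℝ] E →L[ℝ] E) (Y : E → E) (y : E) : E :=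
  nab Γ Y y (Y y)

theorem contDiffAt_selfAccel {Γ : E → E →L[ℝ] E →L[ℝ] E} {Y : E → E} {y : E}
    (hΓ : ContDiffAt ℝ ∞ Γ y) (hY : ContDiffAt ℝ ∞ Y y) : ContDiffAt ℝ ∞ (selfAccel Γ Y) y :=
  (contDiffAt_nab hΓ hY).clm_apply hY

/-- The covariant derivative is a derivation. -/
theorem nab_smul {Γ : E → E →L[ℝ] E →L[ℝ] E} {Y : E → E} {f : E → ℝ} {y : E}
    (hf : DifferentiableAt ℝ f y) (hY : DifferentiableAt ℝ Y y) :
    nab Γ (fun z ↦ f z • Y z) y = f y • nab Γ Y y + (fderiv ℝ f y).smulRight (Y y) := by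
  ext u
  rw [nab_apply, fderiv_fun_smul hf hY]
  simp [nab_apply]
  abel

theorem nab_add {Γ : E → E →L[ℝ] E →L[ℝ] E} {Y Z : E → E} {y : E}
    (hY : DifferentiableAt ℝ Y y) (hZ : DifferentiableAt ℝ Z y) :
    nab Γ (fun z ↦ Y z + Z z) y = nab Γ Y y + nab Γ Z y := by
  ext u
  rw [nab_apply, fderiv_fun_add hY hZ]
  simp [nab_apply]
  abel

theorem nab_congr {Γ : E → E →L[ℝ] E →L[ℝ] E} {Y Z : E → E} {y : E}
    (h : Y =ᶠ[nhds y] Z) : nab Γ Y y = nab Γ Z y := by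
  rw [nab, nab, h.fderiv_eq, h.eq_of_nhds]

/-! ### Traces of endomorphism fields and the divergence form of `Ric(Y, Y)`. -/

section Trace

variable [FiniteDimensional ℝ E]

variable (E) in
/-- The trace as a continuous linear functional. -/
noncomputable def traceL : (E →L[ℝ] E) →L[ℝ] ℝ :=
  LinearMap.toContinuousLinearMap (LinearMap.trace ℝ E ∘ₗ ContinuousLinearMap.coeLM ℝ)

theorem traceL_apply (A : E →L[ℝ] E) : traceL E A = LinearMap.trace ℝ E (A : E →ₗ[ℝ] E) := rfl

theorem traceL_comp_comm (A B : E →L[ℝ] E) : traceL E (A ∘L B) = traceL E (B ∘L A) :=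
  LinearMap.trace_mul_comm ℝ (A : E →ₗ[ℝ] E) (B : E →ₗ[ℝ] E)

@[simp]
theorem traceL_smulRight (f : E →L[ℝ] ℝ) (v : E) : traceL E (f.smulRight v) = f v :=
  LinearMap.trace_smulRight (f : E →ₗ[ℝ] ℝ) v

theorem traceL_eq_sum (A : E →L[ℝ] E) :
    traceL E A = ∑ i, (Module.finBasis ℝ E).coord i (A (Module.finBasis ℝ E i)) := by
  rw [traceL_apply, LinearMap.trace_eq_matrix_trace ℝ (Module.finBasis ℝ E), Matrix.trace]
  simp [LinearMap.toMatrix_apply]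

/-- The trace is invariant under conjugation. -/
theorem traceL_eq_of_intertwine {A B P : E →L[ℝ] E} (hP : P.IsInvertible)
    (h : P ∘L A = B ∘L P) : traceL E A = traceL E B := by
  have hA : A = P.inverse ∘L (B ∘L P) := by
    rw [← h, ← ContinuousLinearMap.comp_assoc, hP.inverse_comp_self,
      ContinuousLinearMap.id_comp]
  rw [hA, traceL_comp_comm, ContinuousLinearMap.comp_assoc, hP.self_comp_inverse,
    ContinuousLinearMap.comp_id]

theorem fderiv_traceL {A : E → E →L[ℝ] E} {y : E} (hA : DifferentiableAt ℝ A y) (u : E) :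
    fderiv ℝ (fun z ↦ traceL E (A z)) y u = traceL E (fderiv ℝ A y u) := by
  have := ((traceL E).hasFDerivAt.comp y hA.hasFDerivAt).fderiv
  exact congrArg (fun T : E →L[ℝ] ℝ ↦ T u) this

/-- The expression `div ∇_Y Y - Y (div Y) - tr (∇ Y)²`, which is `Ric(Y, Y)`. -/
noncomputable def bochner (Γ : E → E →L[ℝ] E →L[ℝ] E) (Y : E → E) (y : E) : ℝ :=
  traceL E (nab Γ (selfAccel Γ Y) y) - fderiv ℝ (fun z ↦ traceL E (nab Γ Y z)) y (Y y)
    - traceL E (nab Γ Y y ∘L nab Γ Y y)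

theorem contDiffAt_bochner {Γ : E → E →L[ℝ] E →L[ℝ] E} {Y : E → E} {y : E}
    (hΓ : ContDiffAt ℝ ∞ Γ y) (hY : ContDiffAt ℝ ∞ Y y) : ContDiffAt ℝ ∞ (bochner Γ Y) y := by
  have hA := contDiffAt_nab hΓ hY
  have hT : ∀ {B : E → E →L[ℝ] E}, ContDiffAt ℝ ∞ B y →
      ContDiffAt ℝ ∞ (fun z ↦ traceL E (B z)) y := fun hB ↦
    (traceL E).contDiff.contDiffAt.comp y hB
  exact ((hT (contDiffAt_nab hΓ (contDiffAt_selfAccel hΓ hY))).sub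
    ((hT hA).fderiv_of_top.clm_apply hY)).sub (hT (hA.clm_comp hA))

/-- The trace of the curvature of a symmetric connection, contracted twice with `Y`. -/
theorem traceL_curvature_eq_bochner {Γ : E → E →L[ℝ] E →L[ℝ] E} {Y : E → E} {y : E}
    (hΓ : ContDiffAt ℝ ∞ Γ y) (hY : ContDiffAt ℝ ∞ Y y) (hs : ∀ u v, Γ y u v = Γ y v u)
    {R : E →L[ℝ] E} (hR : ∀ u, R u = fderiv ℝ Γ y u (Y y) (Y y) - fderiv ℝ Γ y (Y y) u (Y y)
      + Γ y u (Γ y (Y y) (Y y)) - Γ y (Y y) (Γ y u (Y y))) :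
    traceL E R = bochner Γ Y y := by
  have hA := contDiffAt_nab hΓ hY
  -- The second derivatives of `Y` cancel by symmetry. The derivative of `∇Y` along `Y` is the
  -- coordinate one, not the covariant one; the discrepancy is a commutator, which the trace does
  -- not see.
  have key : nab Γ (selfAccel Γ Y) y - fderiv ℝ (nab Γ Y) y (Y y) - nab Γ Y y ∘L nab Γ Y y
      = R + (Γ y (Y y) ∘L fderiv ℝ Y y - fderiv ℝ Y y ∘L Γ y (Y y)) := by
    ext u
    simp only [sub_apply, add_apply,
      ContinuousLinearMap.comp_apply]
    rw [hR, nab_apply Γ (selfAccel Γ Y)]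
    have h1 : fderiv ℝ (selfAccel Γ Y) y u
        = fderiv ℝ (nab Γ Y) y u (Y y) + nab Γ Y y (fderiv ℝ Y y u) :=
      fderiv_apply_vec hA.differentiableAt_of_top hY.differentiableAt_of_top u
    rw [h1, fderiv_nab hΓ hY, fderiv_nab hΓ hY, hY.fderiv_fderiv_symm u]
    simp only [selfAccel, nab_apply, map_add]
    rw [hs (Γ y u (Y y)) (Y y), hs u (Y y)]
    abel
  have := congrArg (traceL E) key
  simp only [map_sub, map_add, traceL_comp_comm (Γ y (Y y)), sub_self, add_zero] at this
  rw [← this, bochner, fderiv_traceL hA.differentiableAt_of_top]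

end Trace

/-! ### Naturality under a local diffeomorphism -/

section Naturality

variable {Γ Γ' : E → E →L[ℝ] E →L[ℝ] E} {φ : E → E} {Y Y' : E → E} {y : E}

/-- Obtained by differentiating the relation `Dφ(Y') = Y ∘ φ`. The term in `D²φ` is the one that the
inhomogeneous part of the Christoffel transformation law compensates. -/
theorem related_fderiv {φ : E → E} {Y Y' : E → E} {y : E} (hφ : ContDiffAt ℝ ∞ φ y)
    (hY : DifferentiableAt ℝ Y (φ y)) (hY' : DifferentiableAt ℝ Y' y)
    (h : ∀ᶠ z in nhds y, fderiv ℝ φ z (Y' z) = Y (φ z)) (u : E) :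
    fderiv ℝ (fderiv ℝ φ) y u (Y' y) + fderiv ℝ φ y (fderiv ℝ Y' y u)
      = fderiv ℝ Y (φ y) (fderiv ℝ φ y u) := by
  have h1 := fderiv_apply_vec hφ.fderiv_of_top.differentiableAt_of_top hY' u
  rw [← h1, Filter.EventuallyEq.fderiv_eq h]
  have := (hY.hasFDerivAt.comp y hφ.differentiableAt_of_top.hasFDerivAt).fderiv
  exact congrArg (fun T : E →L[ℝ] E ↦ T u) this

/-- The hypothesis `hΓ` is the transformation law of a connection; its `D²φ` term cancels the one of
`related_fderiv`, so `∇Y` transforms by conjugation. -/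
theorem related_nab (hφ : ContDiffAt ℝ ∞ φ y)
    (hY : DifferentiableAt ℝ Y (φ y)) (hY' : DifferentiableAt ℝ Y' y)
    (h : ∀ᶠ z in nhds y, fderiv ℝ φ z (Y' z) = Y (φ z))
    (hΓ : ∀ u v, fderiv ℝ φ y (Γ' y u v)
      = Γ (φ y) (fderiv ℝ φ y u) (fderiv ℝ φ y v) + fderiv ℝ (fderiv ℝ φ) y u v) :
    fderiv ℝ φ y ∘L nab Γ' Y' y = nab Γ Y (φ y) ∘L fderiv ℝ φ y := by
  ext u
  simp only [ContinuousLinearMap.comp_apply, nab_apply, map_add]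
  rw [hΓ, ← related_fderiv hφ hY hY' h, h.self_of_nhds]
  abel

/-- Conjugate endomorphisms have equal traces, and this applies to `∇(∇_Y Y)`, `∇Y` and `(∇Y)²`. The
relations are required on a neighbourhood because `∇_Y Y` and `div Y` are differentiated once more.
-/
theorem related_bochner [FiniteDimensional ℝ E]
    (hφ : ∀ᶠ z in nhds y, ContDiffAt ℝ ∞ φ z)
    (hi : ∀ᶠ z in nhds y, (fderiv ℝ φ z).IsInvertible)
    (hY : ∀ᶠ z in nhds (φ y), ContDiffAt ℝ ∞ Y z) (hY' : ∀ᶠ z in nhds y, ContDiffAt ℝ ∞ Y' z)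
    (hΓs : ContDiffAt ℝ ∞ Γ (φ y)) (hΓs' : ContDiffAt ℝ ∞ Γ' y)
    (h : ∀ᶠ z in nhds y, fderiv ℝ φ z (Y' z) = Y (φ z))
    (hΓ : ∀ᶠ z in nhds y, ∀ u v, fderiv ℝ φ z (Γ' z u v)
      = Γ (φ z) (fderiv ℝ φ z u) (fderiv ℝ φ z v) + fderiv ℝ (fderiv ℝ φ) z u v) :
    fderiv ℝ φ y (selfAccel Γ' Y' y) = selfAccel Γ Y (φ y) ∧
      bochner Γ' Y' y = bochner Γ Y (φ y) := by
  have hYφ : ∀ᶠ z in nhds y, ContDiffAt ℝ ∞ Y (φ z) :=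
    hφ.self_of_nhds.continuousAt.eventually hY
  have hA : ∀ᶠ z in nhds y, fderiv ℝ φ z ∘L nab Γ' Y' z = nab Γ Y (φ z) ∘L fderiv ℝ φ z := by
    filter_upwards [hφ, hYφ, hY', h.eventually_nhds, hΓ] with z h1 h2 h3 h4 h5
    exact related_nab h1 h2.differentiableAt_of_top h3.differentiableAt_of_top h4 h5
  have ha : ∀ᶠ z in nhds y, fderiv ℝ φ z (selfAccel Γ' Y' z) = selfAccel Γ Y (φ z) := by
    filter_upwards [hA, h] with z h1 h2
    have := congrArg (fun T : E →L[ℝ] E ↦ T (Y' z)) h1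
    simp only [ContinuousLinearMap.comp_apply] at this
    rw [selfAccel, selfAccel, this, h2]
  have htr : (fun z ↦ traceL E (nab Γ' Y' z)) =ᶠ[nhds y] fun z ↦ traceL E (nab Γ Y (φ z)) := by
    filter_upwards [hA, hi] with z h1 h2
    exact traceL_eq_of_intertwine h2 h1
  refine ⟨ha.self_of_nhds, ?_⟩
  have hAY := contDiffAt_nab hΓs hY.self_of_nhds
  rw [bochner, bochner]
  congr 1
  · congr 1
    · refine traceL_eq_of_intertwine hi.self_of_nhds ?_
      exact related_nab hφ.self_of_nhds
        (contDiffAt_selfAccel hΓs hY.self_of_nhds).differentiableAt_of_top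
        (contDiffAt_selfAccel hΓs' hY'.self_of_nhds).differentiableAt_of_top ha hΓ.self_of_nhds
    · rw [htr.fderiv_eq, ← h.self_of_nhds]
      have h1 : DifferentiableAt ℝ (fun w ↦ traceL E (nab Γ Y w)) (φ y) :=
        ((traceL E).contDiff.contDiffAt.comp _ hAY).differentiableAt_of_top
      have := (h1.hasFDerivAt.comp y hφ.self_of_nhds.differentiableAt_of_top.hasFDerivAt).fderiv
      exact congrArg (fun T : E →L[ℝ] ℝ ↦ T (Y' y)) this
  · refine traceL_eq_of_intertwine hi.self_of_nhds ?_
    have := hA.self_of_nhds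
    rw [← ContinuousLinearMap.comp_assoc, this, ContinuousLinearMap.comp_assoc, this,
      ContinuousLinearMap.comp_assoc]

end Naturality

/-! ### The Levi-Civita connection on the model space -/

section LeviCivita

variable {G : E → E →L[ℝ] E →L[ℝ] ℝ} {y : E}

/-- `christoffelFirst` as a bundled bilinear map. -/
noncomputable def christoffelFirstL (G : E → E →L[ℝ] E →L[ℝ] ℝ) (y : E) :
    E →L[ℝ] E →L[ℝ] E →L[ℝ] ℝ :=
  (2⁻¹ : ℝ) • (fderiv ℝ G y + (fderiv ℝ G y).flip
    - ((ContinuousLinearMap.flipₗᵢ ℝ E E ℝ).toContinuousLinearEquiv :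
        (E →L[ℝ] E →L[ℝ] ℝ) →L[ℝ] (E →L[ℝ] E →L[ℝ] ℝ)) ∘L (fderiv ℝ G y).flip)

theorem christoffelFirstL_apply (u v : E) :
    christoffelFirstL G y u v = christoffelFirst G y u v := by
  ext w
  simp [christoffelFirstL, christoffelFirst_apply]

/-- `christoffel` as a bundled bilinear map. -/
noncomputable def christoffelL (G : E → E →L[ℝ] E →L[ℝ] ℝ) (y : E) : E →L[ℝ] E →L[ℝ] E :=
  ContinuousLinearMap.compL ℝ E (E →L[ℝ] ℝ) E (G y).inverse ∘L christoffelFirstL G y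

theorem christoffelL_apply (u v : E) : christoffelL G y u v = christoffel G y u v := by
  simp [christoffelL, christoffel, christoffelFirstL_apply]

theorem _root_.ContDiffAt.clm_inverse [CompleteSpace E] {F : Type*} [NormedAddCommGroup F]
    [NormedSpace ℝ F] {A : E → E →L[ℝ] F} {n : WithTop ℕ∞} (hA : ContDiffAt ℝ n A y)
    (hi : (A y).IsInvertible) : ContDiffAt ℝ n (fun z ↦ (A z).inverse) y :=
  hi.contDiffAt_map_inverse.comp y hA

theorem contDiffAt_christoffelL [CompleteSpace E] (hG : ContDiffAt ℝ ∞ G y)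
    (hi : (G y).IsInvertible) : ContDiffAt ℝ ∞ (christoffelL G) y := by
  have hD := hG.fderiv_of_top
  have hF : ContDiffAt ℝ ∞ (fun z ↦ (fderiv ℝ G z).flip) y :=
    (ContinuousLinearMap.flipₗᵢ ℝ E E (E →L[ℝ] ℝ)).contDiff.contDiffAt.comp y hD
  have h1 : ContDiffAt ℝ ∞ (christoffelFirstL G) y :=
    ((hD.add hF).sub (contDiffAt_const.clm_comp hF)).const_smul _
  exact ((ContinuousLinearMap.compL ℝ E (E →L[ℝ] ℝ) E).contDiff.contDiffAt.comp y
    (hG.clm_inverse hi)).clm_comp h1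

theorem fderiv_bilin_symm (hG : DifferentiableAt ℝ G y)
    (hs : ∀ᶠ z in nhds y, ∀ u v, G z u v = G z v u) (w u v : E) :
    fderiv ℝ G y w u v = fderiv ℝ G y w v u := by
  have hc : ∀ a b : E, fderiv ℝ (fun z ↦ G z a b) y w = fderiv ℝ G y w a b := fun a b ↦ by
    rw [fderiv_bilin_apply hG (differentiableAt_const a) (differentiableAt_const b)]
    simp
  rw [← hc, ← hc, Filter.EventuallyEq.fderiv_eq (hs.mono fun z hz ↦ hz u v)]

theorem bilin_christoffelL (hi : (G y).IsInvertible) (u v w : E) :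
    G y (christoffelL G y u v) w
      = 2⁻¹ * (fderiv ℝ G y u v w + fderiv ℝ G y v u w - fderiv ℝ G y w u v) := by
  rw [christoffelL_apply, christoffel, hi.self_apply_inverse, christoffelFirst_apply]

theorem christoffelL_symm (hG : DifferentiableAt ℝ G y)
    (hs : ∀ᶠ z in nhds y, ∀ u v, G z u v = G z v u) (hi : (G y).IsInvertible) (u v : E) :
    christoffelL G y u v = christoffelL G y v u := by
  refine hi.injective (ContinuousLinearMap.ext fun w ↦ ?_)
  rw [bilin_christoffelL hi, bilin_christoffelL hi, fderiv_bilin_symm hG hs w u v]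
  ring

/-- The Levi-Civita connection is metric. -/
theorem fderiv_bilin_eq_christoffelL (hG : DifferentiableAt ℝ G y)
    (hs : ∀ᶠ z in nhds y, ∀ u v, G z u v = G z v u) (hi : (G y).IsInvertible) (u v w : E) :
    fderiv ℝ G y u v w = G y (christoffelL G y u v) w + G y v (christoffelL G y u w) := by
  rw [hs.self_of_nhds v, bilin_christoffelL hi, bilin_christoffelL hi,
    fderiv_bilin_symm hG hs u w v]
  ring

/-- Metric compatibility: lowering the index of `∇_u S` gives the covariant derivative `∇_u L` of
the associated 1-form. -/
theorem bilin_nab (hG : ContDiffAt ℝ ∞ G y)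
    (hs : ∀ᶠ z in nhds y, ∀ u v, G z u v = G z v u) (hi : (G y).IsInvertible)
    {S : E → E} (hS : DifferentiableAt ℝ S y) {L : E → E →L[ℝ] ℝ}
    (hL : ∀ᶠ z in nhds y, G z (S z) = L z) (u w : E) :
    G y (nab (christoffelL G) S y u) w = fderiv ℝ L y u w - L y (christoffelL G y u w) := by
  have h1 : fderiv ℝ L y u = fderiv ℝ G y u (S y) + G y (fderiv ℝ S y u) := by
    rw [← fderiv_apply_vec hG.differentiableAt_of_top hS]
    rw [Filter.EventuallyEq.fderiv_eq (hL.mono fun z hz ↦ hz.symm)]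
  rw [h1, ← hL.self_of_nhds, add_apply,
    fderiv_bilin_eq_christoffelL hG.differentiableAt_of_top hs hi, nab_apply, map_add,
    add_apply]
  ring

variable [FiniteDimensional ℝ E]

/-- `Ric(S, S)` as a divergence expression. -/
theorem ricciModel_eq_bochner (hG : ContDiffAt ℝ ∞ G y)
    (hs : ∀ᶠ z in nhds y, ∀ u v, G z u v = G z v u) (hi : (G y).IsInvertible)
    {S : E → E} (hS : ContDiffAt ℝ ∞ S y) :
    ricciModel G y (S y) (S y) = bochner (christoffelL G) S y := by
  have hΓ := contDiffAt_christoffelL hG hi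
  have hd : ∀ u v w, fderiv ℝ (fun z ↦ christoffel G z v w) y u
      = fderiv ℝ (christoffelL G) y u v w := fun u v w ↦ by
    simp only [← christoffelL_apply]
    rw [fderiv_apply_const (hΓ.differentiableAt_of_top.clm_apply (differentiableAt_const v)),
      fderiv_apply_const hΓ.differentiableAt_of_top]
  let D := fderiv ℝ (christoffelL G) y
  -- The endomorphism `u ↦ R(u, S) S`, bundled so that its trace can be taken.
  let R : E →L[ℝ] E := (D.flip (S y)).flip (S y) - (D (S y)).flip (S y)
    + (christoffelL G y).flip (christoffelL G y (S y) (S y))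
    - christoffelL G y (S y) ∘L (christoffelL G y).flip (S y)
  rw [← traceL_curvature_eq_bochner (R := R) hΓ hS
    (christoffelL_symm hG.differentiableAt_of_top hs hi) fun u ↦ by simp [R, D], traceL_eq_sum]
  refine Finset.sum_congr rfl fun i _ ↦ ?_
  congr 1
  simp only [curvature, hd]
  simp [R, D, christoffelL_apply]

end LeviCivita

/-! ### Naturality of the Levi-Civita connection and of Lie derivatives -/

section Naturality

variable {G G' : E → E →L[ℝ] E →L[ℝ] ℝ} {φ : E → E} {y : E}

theorem fderiv_pullback_bilin (hφ : ContDiffAt ℝ ∞ φ y) (hG : DifferentiableAt ℝ G (φ y))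
    (hG' : DifferentiableAt ℝ G' y)
    (h : ∀ᶠ z in nhds y, ∀ u v, G' z u v = G (φ z) (fderiv ℝ φ z u) (fderiv ℝ φ z v))
    (w u v : E) :
    fderiv ℝ G' y w u v = fderiv ℝ G (φ y) (fderiv ℝ φ y w) (fderiv ℝ φ y u) (fderiv ℝ φ y v)
      + G (φ y) (fderiv ℝ (fderiv ℝ φ) y w u) (fderiv ℝ φ y v)
      + G (φ y) (fderiv ℝ φ y u) (fderiv ℝ (fderiv ℝ φ) y w v) := by
  have hD := hφ.fderiv_of_top.differentiableAt_of_top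
  have h1 : fderiv ℝ (fun z ↦ G' z u v) y w = fderiv ℝ G' y w u v := by
    rw [fderiv_bilin_apply hG' (differentiableAt_const u) (differentiableAt_const v)]
    simp
  have h2 : fderiv ℝ (G ∘ φ) y w = fderiv ℝ G (φ y) (fderiv ℝ φ y w) := by
    rw [fderiv_comp y hG hφ.differentiableAt_of_top]
    rfl
  rw [← h1, Filter.EventuallyEq.fderiv_eq (h.mono fun z hz ↦ hz u v)]
  have h3 := fderiv_bilin_apply (B := G ∘ φ) (hG.comp y hφ.differentiableAt_of_top)
    (hD.clm_apply (differentiableAt_const u)) (hD.clm_apply (differentiableAt_const v)) w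
  rw [h2, fderiv_apply_const hD, fderiv_apply_const hD] at h3
  exact h3

/-- After lowering the index, both sides are Koszul formulas. Of the six `D²φ` terms produced by the
product rule, four cancel by the symmetry of `G` and `D²φ`, and the other two coincide and absorb
the factor `½`. -/
theorem related_christoffelL (hφ : ContDiffAt ℝ ∞ φ y) (hφi : (fderiv ℝ φ y).IsInvertible)
    (hG : DifferentiableAt ℝ G (φ y)) (hG' : DifferentiableAt ℝ G' y)
    (hs : ∀ u v, G (φ y) u v = G (φ y) v u)
    (hi : (G (φ y)).IsInvertible) (hi' : (G' y).IsInvertible)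
    (h : ∀ᶠ z in nhds y, ∀ u v, G' z u v = G (φ z) (fderiv ℝ φ z u) (fderiv ℝ φ z v))
    (u v : E) :
    fderiv ℝ φ y (christoffelL G' y u v)
      = christoffelL G (φ y) (fderiv ℝ φ y u) (fderiv ℝ φ y v)
        + fderiv ℝ (fderiv ℝ φ) y u v := by
  refine hi.injective (ContinuousLinearMap.ext fun w' ↦ ?_)
  obtain ⟨w, rfl⟩ := hφi.surjective w'
  rw [← h.self_of_nhds, bilin_christoffelL hi', map_add, add_apply, bilin_christoffelL hi]
  simp only [fderiv_pullback_bilin hφ hG hG' h]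
  rw [hs (fderiv ℝ φ y u) (fderiv ℝ (fderiv ℝ φ) y w v), hφ.fderiv_fderiv_symm v u,
    hφ.fderiv_fderiv_symm w u, hφ.fderiv_fderiv_symm w v,
    hs (fderiv ℝ φ y u) (fderiv ℝ (fderiv ℝ φ) y v w),
    hs (fderiv ℝ φ y v) (fderiv ℝ (fderiv ℝ φ) y u w)]
  ring

/-- Differentiating the tensor and differentiating the vector field produce opposite `D²φ` terms, so
Lie derivatives need no connection to be natural. The same holds for 1-forms below. -/
theorem related_lieBilinModel {X X' : E → E} (hφ : ContDiffAt ℝ ∞ φ y)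
    (hG : DifferentiableAt ℝ G (φ y)) (hG' : DifferentiableAt ℝ G' y)
    (hX : DifferentiableAt ℝ X (φ y)) (hX' : DifferentiableAt ℝ X' y)
    (h : ∀ᶠ z in nhds y, ∀ u v, G' z u v = G (φ z) (fderiv ℝ φ z u) (fderiv ℝ φ z v))
    (hr : ∀ᶠ z in nhds y, fderiv ℝ φ z (X' z) = X (φ z)) (u v : E) :
    lieBilinModel X' G' y u v
      = lieBilinModel X G (φ y) (fderiv ℝ φ y u) (fderiv ℝ φ y v) := by
  simp only [lieBilinModel_apply, fderiv_pullback_bilin hφ hG hG' h, h.self_of_nhds,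
    ← related_fderiv hφ hX hX' hr, hr.self_of_nhds, map_add, add_apply]
  rw [hφ.fderiv_fderiv_symm (X' y) u, hφ.fderiv_fderiv_symm (X' y) v]
  ring

theorem related_lieFormModel {X X' : E → E} {L L' : E → E →L[ℝ] ℝ} (hφ : ContDiffAt ℝ ∞ φ y)
    (hL : DifferentiableAt ℝ L (φ y)) (hL' : DifferentiableAt ℝ L' y)
    (hX : DifferentiableAt ℝ X (φ y)) (hX' : DifferentiableAt ℝ X' y)
    (h : ∀ᶠ z in nhds y, ∀ u, L' z u = L (φ z) (fderiv ℝ φ z u))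
    (hr : ∀ᶠ z in nhds y, fderiv ℝ φ z (X' z) = X (φ z)) (u : E) :
    lieFormModel X' L' y u = lieFormModel X L (φ y) (fderiv ℝ φ y u) := by
  have hD := hφ.fderiv_of_top.differentiableAt_of_top
  have h1 : fderiv ℝ L' y (X' y) u
      = fderiv ℝ L (φ y) (fderiv ℝ φ y (X' y)) (fderiv ℝ φ y u)
        + L (φ y) (fderiv ℝ (fderiv ℝ φ) y (X' y) u) := by
    rw [← fderiv_apply_const hL', Filter.EventuallyEq.fderiv_eq (h.mono fun z hz ↦ hz u)]
    have h3 := fderiv_apply_vec (A := L ∘ φ) (hL.comp y hφ.differentiableAt_of_top)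
      (hD.clm_apply (differentiableAt_const u)) (X' y)
    rw [fderiv_comp y hL hφ.differentiableAt_of_top, fderiv_apply_const hD] at h3
    exact h3
  simp only [lieFormModel, add_apply, ContinuousLinearMap.comp_apply, h1, h.self_of_nhds,
    ← related_fderiv hφ hX hX' hr, hr.self_of_nhds, map_add]
  rw [hφ.fderiv_fderiv_symm (X' y) u]
  ring

end Naturality

/-! ### Lie derivatives of the Levi-Civita connection -/

section Lie

variable {G : E → E →L[ℝ] E →L[ℝ] ℝ} {Γ : E → E →L[ℝ] E →L[ℝ] E} {X Y : E → E} {y : E}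

/-- The Lie bracket `[X, Y]` on the model space. -/
noncomputable def bracket (X Y : E → E) (y : E) : E := fderiv ℝ Y y (X y) - fderiv ℝ X y (Y y)

/-- The Lie derivative of a connection. -/
noncomputable def lieConn (X : E → E) (Γ : E → E →L[ℝ] E →L[ℝ] E) (y u v : E) : E :=
  fderiv ℝ Γ y (X y) u v + Γ y (fderiv ℝ X y u) v + Γ y u (fderiv ℝ X y v)
    - fderiv ℝ X y (Γ y u v) + fderiv ℝ (fderiv ℝ X) y u v

theorem fderiv_bracket (hX : ContDiffAt ℝ ∞ X y) (hY : ContDiffAt ℝ ∞ Y y) (u : E) :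
    fderiv ℝ (bracket X Y) y u = fderiv ℝ (fderiv ℝ Y) y u (X y) + fderiv ℝ Y y (fderiv ℝ X y u)
      - (fderiv ℝ (fderiv ℝ X) y u (Y y) + fderiv ℝ X y (fderiv ℝ Y y u)) := by
  have hX' := hX.fderiv_of_top.differentiableAt_of_top
  have hY' := hY.fderiv_of_top.differentiableAt_of_top
  rw [← fderiv_apply_vec hY' hX.differentiableAt_of_top,
    ← fderiv_apply_vec hX' hY.differentiableAt_of_top]
  have := fderiv_sub (hY'.clm_apply hX.differentiableAt_of_top)
    (hX'.clm_apply hY.differentiableAt_of_top)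
  exact congrArg (fun T : E →L[ℝ] E ↦ T u) this

/-- The Lie derivative commutes with the covariant derivative up to `lieConn`. -/
theorem fderiv_nab_along (hΓ : ContDiffAt ℝ ∞ Γ y) (hX : ContDiffAt ℝ ∞ X y)
    (hY : ContDiffAt ℝ ∞ Y y) (u : E) :
    fderiv ℝ (nab Γ Y) y (X y) u = fderiv ℝ X y (nab Γ Y y u) - nab Γ Y y (fderiv ℝ X y u)
      + nab Γ (bracket X Y) y u + lieConn X Γ y u (Y y) := by
  rw [fderiv_nab hΓ hY, nab_apply Γ (bracket X Y), fderiv_bracket hX hY, bracket, lieConn,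
    hY.fderiv_fderiv_symm u]
  simp only [nab_apply, map_add, map_sub]
  abel

theorem fderiv_lieBilinModel (hG : ContDiffAt ℝ ∞ G y) (hX : ContDiffAt ℝ ∞ X y) (u v w : E) :
    fderiv ℝ (lieBilinModel X G) y u v w
      = fderiv ℝ (fderiv ℝ G) y u (X y) v w + fderiv ℝ G y (fderiv ℝ X y u) v w
        + (fderiv ℝ G y u (fderiv ℝ X y v) w + G y (fderiv ℝ (fderiv ℝ X) y u v) w)
        + (fderiv ℝ G y u v (fderiv ℝ X y w) + G y v (fderiv ℝ (fderiv ℝ X) y u w)) := by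
  have hX' := hX.fderiv_of_top
  have hG' := hG.fderiv_of_top
  have hXc : ∀ a, ContDiffAt ℝ ∞ (fun z ↦ fderiv ℝ X z a) y := fun a ↦
    hX'.clm_apply contDiffAt_const
  have hT1 : ContDiffAt ℝ ∞ (fun z ↦ fderiv ℝ G z (X z)) y := hG'.clm_apply hX
  have hT2 : ContDiffAt ℝ ∞ (fun z ↦ (G z).bilinearComp (fderiv ℝ X z) (.id ℝ E)) y := by
    have : (fun z ↦ (G z).bilinearComp (fderiv ℝ X z) (.id ℝ E))
        = fun z ↦ G z ∘L fderiv ℝ X z := by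
      ext z u v
      simp
    rw [this]
    exact hG.clm_comp hX'
  have hT3 : ContDiffAt ℝ ∞ (fun z ↦ (G z).bilinearComp (.id ℝ E) (fderiv ℝ X z)) y := by
    have : (fun z ↦ (G z).bilinearComp (.id ℝ E) (fderiv ℝ X z))
        = fun z ↦ ContinuousLinearMap.flipₗᵢ ℝ E E ℝ
            (ContinuousLinearMap.flipₗᵢ ℝ E E ℝ (G z) ∘L fderiv ℝ X z) := by
      ext z u v
      simp
    rw [this]
    exact (ContinuousLinearMap.flipₗᵢ ℝ E E ℝ).contDiff.contDiffAt.comp y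
      (((ContinuousLinearMap.flipₗᵢ ℝ E E ℝ).contDiff.contDiffAt.comp y hG).clm_comp hX')
  have hK : ContDiffAt ℝ ∞ (lieBilinModel X G) y := (hT1.add hT2).add hT3
  have hc : fderiv ℝ (fun z ↦ lieBilinModel X G z v w) y u
      = fderiv ℝ (lieBilinModel X G) y u v w := by
    rw [fderiv_bilin_apply hK.differentiableAt_of_top (differentiableAt_const v)
      (differentiableAt_const w)]
    simp
  have hd := hG.differentiableAt_of_top
  have e1 := fderiv_bilin_apply (B := fun z ↦ fderiv ℝ G z (X z)) hT1.differentiableAt_of_top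
    (differentiableAt_const v) (differentiableAt_const w) u
  have e2 := fderiv_bilin_apply hd (hXc v).differentiableAt_of_top (differentiableAt_const w) u
  have e3 := fderiv_bilin_apply hd (differentiableAt_const v) (hXc w).differentiableAt_of_top u
  rw [fderiv_apply_vec hG'.differentiableAt_of_top hX.differentiableAt_of_top] at e1
  rw [fderiv_apply_const hX'.differentiableAt_of_top] at e2 e3
  simp only [fderiv_fun_const, Pi.zero_apply, zero_apply, map_zero, add_zero] at e1 e2 e3
  have d1 : DifferentiableAt ℝ (fun z ↦ fderiv ℝ G z (X z) v w) y :=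
    (hT1.differentiableAt_of_top.clm_apply (differentiableAt_const v)).clm_apply
      (differentiableAt_const w)
  have d2 : DifferentiableAt ℝ (fun z ↦ G z (fderiv ℝ X z v) w) y :=
    (hd.clm_apply (hXc v).differentiableAt_of_top).clm_apply (differentiableAt_const w)
  have d3 : DifferentiableAt ℝ (fun z ↦ G z v (fderiv ℝ X z w)) y :=
    (hd.clm_apply (differentiableAt_const v)).clm_apply (hXc w).differentiableAt_of_top
  rw [← hc]
  simp only [lieBilinModel_apply]
  rw [fderiv_fun_add (d1.fun_add d2) d3, fderiv_fun_add d1 d2, add_apply, add_apply, e1, e2, e3,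
    add_apply, add_apply]

/-- With `K = L_X G` this is the classical `½ (∇_u K(v, w) + ∇_v K(u, w) - ∇_w K(u, v))`: for
symmetric `K` and `Γ` the Christoffel corrections collapse to the single term `-K(Γ(u, v), w)`. Thus
`L_X Γ` is known as soon as `L_X G` is. -/
theorem bilin_lieConn [CompleteSpace E] (hG : ContDiffAt ℝ ∞ G y) (hX : ContDiffAt ℝ ∞ X y)
    (hs : ∀ᶠ z in nhds y, ∀ u v, G z u v = G z v u) (hi : ∀ᶠ z in nhds y, (G z).IsInvertible)
    (u v w : E) :
    G y (lieConn X (christoffelL G) y u v) w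
      = 2⁻¹ * (fderiv ℝ (lieBilinModel X G) y u v w + fderiv ℝ (lieBilinModel X G) y v u w
          - fderiv ℝ (lieBilinModel X G) y w u v)
        - lieBilinModel X G y (christoffelL G y u v) w := by
  have hi₀ := hi.self_of_nhds
  have hs₀ := hs.self_of_nhds
  have hG' := hG.fderiv_of_top.differentiableAt_of_top
  have hΓ := (contDiffAt_christoffelL hG hi₀).differentiableAt_of_top
  have hc : ∀ a b c, fderiv ℝ (fun z ↦ fderiv ℝ G z a b c) y (X y)
      = fderiv ℝ (fderiv ℝ G) y (X y) a b c := fun a b c ↦ by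
    rw [fderiv_apply_const ((hG'.clm_apply (differentiableAt_const a)).clm_apply
      (differentiableAt_const b)), fderiv_apply_const (hG'.clm_apply (differentiableAt_const a)),
      fderiv_apply_const hG']
  have hdc : ∀ a b c, DifferentiableAt ℝ (fun z ↦ fderiv ℝ G z a b c) y := fun a b c ↦
    ((hG'.clm_apply (differentiableAt_const a)).clm_apply
      (differentiableAt_const b)).clm_apply (differentiableAt_const c)
  -- The Koszul formula holds near `y`, so it can be differentiated along `X`; this avoids
  -- differentiating the inverse of `G`.
  have e1 : fderiv ℝ G y (X y) (christoffelL G y u v) w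
        + G y (fderiv ℝ (christoffelL G) y (X y) u v) w
      = 2⁻¹ * (fderiv ℝ (fderiv ℝ G) y (X y) u v w + fderiv ℝ (fderiv ℝ G) y (X y) v u w
          - fderiv ℝ (fderiv ℝ G) y (X y) w u v) := by
    have h1 := fderiv_bilin_apply hG.differentiableAt_of_top
      ((hΓ.clm_apply (differentiableAt_const u)).clm_apply (differentiableAt_const v))
      (differentiableAt_const w) (X y)
    rw [fderiv_apply_const (hΓ.clm_apply (differentiableAt_const u)), fderiv_apply_const hΓ,
      Filter.EventuallyEq.fderiv_eq (hi.mono fun z hz ↦ bilin_christoffelL hz u v w),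
      fderiv_const_mul (((hdc u v w).fun_add (hdc v u w)).fun_sub (hdc w u v)),
      fderiv_fun_sub ((hdc u v w).fun_add (hdc v u w)) (hdc w u v),
      fderiv_fun_add (hdc u v w) (hdc v u w)] at h1
    simp [hc] at h1
    linarith
  have s1 := hG.fderiv_fderiv_symm u (X y)
  have s2 := hG.fderiv_fderiv_symm v (X y)
  have s3 := hG.fderiv_fderiv_symm w (X y)
  have hsd := fderiv_bilin_symm hG.differentiableAt_of_top hs
  simp only [lieConn, map_add, map_sub, add_apply, sub_apply,
    fderiv_lieBilinModel hG hX, lieBilinModel_apply]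
  rw [s1, s2, s3, bilin_christoffelL hi₀ (fderiv ℝ X y u) v w,
    bilin_christoffelL hi₀ u (fderiv ℝ X y v) w, bilin_christoffelL hi₀ u v (fderiv ℝ X y w),
    hX.fderiv_fderiv_symm v u, hX.fderiv_fderiv_symm w u, hX.fderiv_fderiv_symm w v,
    hs₀ v (fderiv ℝ (fderiv ℝ X) y u w), hs₀ u (fderiv ℝ (fderiv ℝ X) y v w)]
  linarith [e1, hsd w (fderiv ℝ X y u) v]

end Lie

/-! ### Kerr-Schild vector fields on the model space -/

/-- Near `y`, `L` is a smooth null 1-form for the metric `G`, with associated vector field `S`. -/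
structure NullFormNear (G : E → E →L[ℝ] E →L[ℝ] ℝ) (L : E → E →L[ℝ] ℝ) (S : E → E)
    (y : E) : Prop where
  smooth_metric : ∀ᶠ z in nhds y, ContDiffAt ℝ ∞ G z
  smooth_form : ∀ᶠ z in nhds y, ContDiffAt ℝ ∞ L z
  smooth_sharp : ∀ᶠ z in nhds y, ContDiffAt ℝ ∞ S z
  symm : ∀ᶠ z in nhds y, ∀ u v, G z u v = G z v u
  inv : ∀ᶠ z in nhds y, (G z).IsInvertible
  sharp_eq : ∀ᶠ z in nhds y, G z (S z) = L z
  null : ∀ᶠ z in nhds y, L z (S z) = 0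

/-- Near `y`, `X` is a Kerr-Schild vector field of the metric `G` with respect to the null 1-form
`L` with associated vector field `S`. -/
structure KerrSchildNear (G : E → E →L[ℝ] E →L[ℝ] ℝ) (L : E → E →L[ℝ] ℝ) (S X : E → E)
    (h m : E → ℝ) (y : E) : Prop extends NullFormNear G L S y where
  smooth_field : ∀ᶠ z in nhds y, ContDiffAt ℝ ∞ X z
  smooth_h : ∀ᶠ z in nhds y, ContDiffAt ℝ ∞ h z
  smooth_m : ∀ᶠ z in nhds y, ContDiffAt ℝ ∞ m z
  lie_metric : ∀ᶠ z in nhds y, ∀ u v, lieBilinModel X G z u v = 2 * h z * (L z u * L z v)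
  lie_form : ∀ᶠ z in nhds y, ∀ u, lieFormModel X L z u = m z * L z u

variable {G : E → E →L[ℝ] E →L[ℝ] ℝ} {L : E → E →L[ℝ] ℝ} {S X : E → E} {h m : E → ℝ} {y : E}

/-! ### Identities for a null 1-form and its acceleration. -/

namespace NullFormNear

theorem eventually (H : NullFormNear G L S y) : ∀ᶠ z in nhds y, NullFormNear G L S z := by
  filter_upwards [H.1.eventually_nhds, H.2.eventually_nhds, H.3.eventually_nhds,
    H.4.eventually_nhds, H.5.eventually_nhds, H.6.eventually_nhds, H.7.eventually_nhds]
    with z h1 h2 h3 h4 h5 h6 h7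
  exact ⟨h1, h2, h3, h4, h5, h6, h7⟩

variable (H : NullFormNear G L S y)
include H

theorem fderiv_form (u w : E) :
    fderiv ℝ L y u w = G y (nab (christoffelL G) S y u) w + L y (christoffelL G y u w) := by
  rw [bilin_nab H.smooth_metric.self_of_nhds H.symm H.inv.self_of_nhds
    H.smooth_sharp.self_of_nhds.differentiableAt_of_top H.sharp_eq]
  ring

theorem bilin_sharp (w : E) : G y w (S y) = L y w := by
  rw [H.symm.self_of_nhds, H.sharp_eq.self_of_nhds]

/-- Half the derivative of `g(S, S) = 0`: every `∇_u S` is orthogonal to `S`. -/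
theorem form_nab (u : E) : L y (nab (christoffelL G) S y u) = 0 := by
  have h1 := fderiv_apply_vec H.smooth_form.self_of_nhds.differentiableAt_of_top
    H.smooth_sharp.self_of_nhds.differentiableAt_of_top u
  have h2 : fderiv ℝ (fun z ↦ L z (S z)) y u = 0 := by
    rw [Filter.EventuallyEq.fderiv_eq (f₁ := fun z ↦ L z (S z)) (f := fun _ ↦ (0 : ℝ)) H.null]
    simp
  rw [h2, H.fderiv_form, H.bilin_sharp] at h1
  have h3 : L y (nab (christoffelL G) S y u)
      = L y (fderiv ℝ S y u) + L y (christoffelL G y u (S y)) := by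
    rw [nab_apply, map_add]
  linarith

theorem form_accel : L y (selfAccel (christoffelL G) S y) = 0 := H.form_nab _

theorem eq_of_bilin_eq {a b : E} (hab : ∀ w, G y a w = G y b w) : a = b :=
  H.inv.self_of_nhds.injective (ContinuousLinearMap.ext hab)

theorem smooth_connection [CompleteSpace E] : ContDiffAt ℝ ∞ (christoffelL G) y :=
  contDiffAt_christoffelL H.smooth_metric.self_of_nhds H.inv.self_of_nhds

theorem smooth_nab [CompleteSpace E] : ContDiffAt ℝ ∞ (nab (christoffelL G) S) y :=
  contDiffAt_nab H.smooth_connection H.smooth_sharp.self_of_nhds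

theorem smooth_accel [CompleteSpace E] : ContDiffAt ℝ ∞ (selfAccel (christoffelL G) S) y :=
  contDiffAt_selfAccel H.smooth_connection H.smooth_sharp.self_of_nhds

end NullFormNear

/-! ### Derivatives of `∇S`, `a²` and `Ric(S, S)` along a Kerr-Schild field. -/

namespace KerrSchildNear

theorem eventually (H : KerrSchildNear G L S X h m y) :
    ∀ᶠ z in nhds y, KerrSchildNear G L S X h m z := by
  filter_upwards [H.toNullFormNear.eventually, H.2.eventually_nhds, H.3.eventually_nhds,
    H.4.eventually_nhds, H.5.eventually_nhds, H.6.eventually_nhds] with z h1 h2 h3 h4 h5 h6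
  exact ⟨h1, h2, h3, h4, h5, h6⟩

variable (H : KerrSchildNear G L S X h m y)
include H

theorem fderiv_lie_metric (u v w : E) :
    fderiv ℝ (lieBilinModel X G) y u v w = 2 * fderiv ℝ h y u * (L y v * L y w)
      + 2 * h y * (fderiv ℝ L y u v * L y w + L y v * fderiv ℝ L y u w) := by
  have hL := H.smooth_form.self_of_nhds.differentiableAt_of_top
  have hh := H.smooth_h.self_of_nhds.differentiableAt_of_top
  have hLc : ∀ a, DifferentiableAt ℝ (fun z ↦ L z a) y := fun a ↦
    hL.clm_apply (differentiableAt_const a)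
  have hK : lieBilinModel X G =ᶠ[nhds y] fun z ↦ (2 * h z) • (L z).smulRight (L z) := by
    filter_upwards [H.lie_metric] with z hz
    ext a b
    simp [hz, mul_assoc]
  have hd : DifferentiableAt ℝ (lieBilinModel X G) y := by
    refine DifferentiableAt.congr_of_eventuallyEq ?_ hK
    refine (hh.const_mul 2).fun_smul ?_
    exact (ContinuousLinearMap.smulRightL ℝ E (E →L[ℝ] ℝ)).isBoundedBilinearMap.contDiff
      |>.differentiable one_ne_zero |>.differentiableAt |>.comp y (hL.prodMk hL)
  have hc : fderiv ℝ (fun z ↦ lieBilinModel X G z v w) y u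
      = fderiv ℝ (lieBilinModel X G) y u v w := by
    rw [fderiv_bilin_apply hd (differentiableAt_const v) (differentiableAt_const w)]
    simp
  rw [← hc, Filter.EventuallyEq.fderiv_eq (H.lie_metric.mono fun z hz ↦ hz v w),
    fderiv_fun_mul (hh.const_mul 2) ((hLc v).fun_mul (hLc w)), fderiv_fun_mul (hLc v) (hLc w),
    fderiv_const_mul hh]
  simp only [add_apply, smul_apply, smul_eq_mul, fderiv_apply_const hL]
  ring

/-- `bilin_lieConn` with `K = 2 h L ⊗ L`. Writing the derivatives of `L` through `∇S` makes all
Christoffel terms cancel. -/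
theorem bilin_lieConn_eq [CompleteSpace E] (u v w : E) :
    G y (lieConn X (christoffelL G) y u v) w
      = fderiv ℝ h y u * (L y v * L y w) + fderiv ℝ h y v * (L y u * L y w)
        - fderiv ℝ h y w * (L y u * L y v)
        + h y * (G y (nab (christoffelL G) S y u) v * L y w
            + L y v * G y (nab (christoffelL G) S y u) w
            + G y (nab (christoffelL G) S y v) u * L y w
            + L y u * G y (nab (christoffelL G) S y v) w
            - G y (nab (christoffelL G) S y w) u * L y v
            - L y u * G y (nab (christoffelL G) S y w) v) := by
  rw [bilin_lieConn H.smooth_metric.self_of_nhds H.smooth_field.self_of_nhds H.symm H.inv,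
    H.lie_metric.self_of_nhds]
  simp only [H.fderiv_lie_metric, H.fderiv_form]
  have hΓ := christoffelL_symm H.smooth_metric.self_of_nhds.differentiableAt_of_top H.symm
    H.inv.self_of_nhds
  rw [hΓ v u, hΓ w u, hΓ w v]
  ring

/-- Every term containing `L(S)` or `g(∇_w S, S)` drops out; the rest points along `S` and the
acceleration. -/
theorem lieConn_sharp [CompleteSpace E] (u : E) :
    lieConn X (christoffelL G) y u (S y)
      = (fderiv ℝ h y (S y) * L y u + h y * G y (selfAccel (christoffelL G) S y) u) • S y
        + (h y * L y u) • selfAccel (christoffelL G) S y := by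
  refine H.eq_of_bilin_eq fun w ↦ ?_
  rw [H.bilin_lieConn_eq, H.null.self_of_nhds]
  simp only [map_add, map_smul, add_apply, smul_apply, smul_eq_mul, H.sharp_eq.self_of_nhds,
    H.bilin_sharp, H.form_nab, selfAccel]
  ring

/-- Take the Lie derivative of `G(S) = L`: the term `(L_X G)(S, ·) = 2 h L(S) L` vanishes because
`S` is null. -/
theorem bracket_sharp : bracket X S y = m y • S y := by
  refine H.eq_of_bilin_eq fun w ↦ ?_
  have hG := H.smooth_metric.self_of_nhds.differentiableAt_of_top
  have hS := H.smooth_sharp.self_of_nhds.differentiableAt_of_top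
  have h1 := congrArg (fun T : E →L[ℝ] ℝ ↦ T w) (fderiv_apply_vec hG hS (X y))
  rw [Filter.EventuallyEq.fderiv_eq H.sharp_eq] at h1
  have h2 := H.lie_form.self_of_nhds w
  have h3 := H.lie_metric.self_of_nhds (S y) w
  rw [H.null.self_of_nhds, lieBilinModel_apply, H.sharp_eq.self_of_nhds] at h3
  simp only [lieFormModel, add_apply, ContinuousLinearMap.comp_apply] at h1 h2
  simp only [bracket, map_sub, sub_apply, map_smul, smul_apply, smul_eq_mul,
    H.sharp_eq.self_of_nhds]
  linarith

/-- The commutator with `∂X` is the coordinate part of the Lie derivative and has trace zero; the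
remaining lines are `∇(m S)` and `(L_X Γ)(·, S)`. -/
theorem fderiv_nab_sharp [CompleteSpace E] :
    fderiv ℝ (nab (christoffelL G) S) y (X y)
      = fderiv ℝ X y ∘L nab (christoffelL G) S y - nab (christoffelL G) S y ∘L fderiv ℝ X y
        + (m y • nab (christoffelL G) S y + (fderiv ℝ m y).smulRight (S y))
        + ((fderiv ℝ h y (S y) • L y
            + h y • G y (selfAccel (christoffelL G) S y)).smulRight (S y)
          + (h y • L y).smulRight (selfAccel (christoffelL G) S y)) := by
  ext u
  rw [fderiv_nab_along H.smooth_connection H.smooth_field.self_of_nhds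
    H.smooth_sharp.self_of_nhds, nab_congr (H.eventually.mono fun z hz ↦ hz.bracket_sharp),
    nab_smul H.smooth_m.self_of_nhds.differentiableAt_of_top
      H.smooth_sharp.self_of_nhds.differentiableAt_of_top, H.lieConn_sharp]
  simp

/-- Evaluating `fderiv_nab_sharp` on `S` removes all of `L_X Γ`, since `L(S) = 0` and `g(a, S) = 0`.
Hence `h` does not occur. -/
theorem bracket_accel [CompleteSpace E] :
    bracket X (selfAccel (christoffelL G) S) y
      = (2 * m y) • selfAccel (christoffelL G) S y + fderiv ℝ m y (S y) • S y := by
  have h1 : fderiv ℝ (selfAccel (christoffelL G) S) y (X y)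
      = fderiv ℝ (nab (christoffelL G) S) y (X y) (S y)
        + nab (christoffelL G) S y (fderiv ℝ S y (X y)) :=
    fderiv_apply_vec H.smooth_nab.differentiableAt_of_top
      H.smooth_sharp.self_of_nhds.differentiableAt_of_top (X y)
  have h2 : fderiv ℝ S y (X y) = fderiv ℝ X y (S y) + m y • S y := by
    rw [← H.bracket_sharp, bracket]
    abel
  rw [bracket, h1, h2, H.fderiv_nab_sharp]
  simp only [add_apply, sub_apply, smul_apply, ContinuousLinearMap.comp_apply,
    ContinuousLinearMap.smulRight_apply, map_add, map_smul, H.null.self_of_nhds,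
    H.bilin_sharp, H.form_accel, smul_eq_mul, mul_zero, add_zero, zero_smul]
  simp only [selfAccel]
  module

/-- The square of the acceleration scales with weight four along a Kerr-Schild field. -/
theorem fderiv_accelSq [CompleteSpace E] :
    fderiv ℝ (fun z ↦ G z (selfAccel (christoffelL G) S z) (selfAccel (christoffelL G) S z)) y (X y)
      = 4 * m y * G y (selfAccel (christoffelL G) S y) (selfAccel (christoffelL G) S y) := by
  have ha := H.smooth_accel.differentiableAt_of_top
  rw [fderiv_bilin_apply H.smooth_metric.self_of_nhds.differentiableAt_of_top ha ha]
  have h3 := H.lie_metric.self_of_nhds (selfAccel (christoffelL G) S y)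
    (selfAccel (christoffelL G) S y)
  rw [H.form_accel, lieBilinModel_apply] at h3
  have h4 : fderiv ℝ (selfAccel (christoffelL G) S) y (X y)
      = fderiv ℝ X y (selfAccel (christoffelL G) S y)
        + ((2 * m y) • selfAccel (christoffelL G) S y + fderiv ℝ m y (S y) • S y) := by
    rw [← H.bracket_accel, bracket]
    abel
  rw [h4]
  simp only [map_add, map_smul, add_apply, smul_apply, smul_eq_mul, H.sharp_eq.self_of_nhds,
    H.bilin_sharp, H.form_accel]
  linarith

variable [FiniteDimensional ℝ E]

/-- The contributions of `L_X Γ` to the trace are multiples of `L(S)`, `g(a, S)` and `L(a)`, all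
zero. -/
theorem fderiv_div_sharp :
    fderiv ℝ (fun z ↦ traceL E (nab (christoffelL G) S z)) y (X y)
      = m y * traceL E (nab (christoffelL G) S y) + fderiv ℝ m y (S y) := by
  rw [fderiv_traceL H.smooth_nab.differentiableAt_of_top, H.fderiv_nab_sharp]
  simp only [map_add, map_sub, map_smul, traceL_smulRight, traceL_comp_comm (fderiv ℝ X y),
    add_apply, smul_apply, smul_eq_mul, H.null.self_of_nhds, H.bilin_sharp, H.form_accel]
  ring

/-- The trace of `(L_X Γ)(·, a)` consists of `h a²` and `-h a²`, besides terms that vanish because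
`S` is null; therefore `h` is absent here too. -/
theorem fderiv_div_accel :
    fderiv ℝ (fun z ↦ traceL E (nab (christoffelL G) (selfAccel (christoffelL G) S) z)) y (X y)
      = 2 * m y * traceL E (nab (christoffelL G) (selfAccel (christoffelL G) S) y)
        + 2 * fderiv ℝ m y (selfAccel (christoffelL G) S y)
        + fderiv ℝ m y (S y) * traceL E (nab (christoffelL G) S y)
        + fderiv ℝ (fun z ↦ fderiv ℝ m z (S z)) y (S y) := by
  have hm := H.smooth_m.self_of_nhds
  have hS := H.smooth_sharp.self_of_nhds
  have hi := H.inv.self_of_nhds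
  have ha := H.smooth_accel
  have hmS : ContDiffAt ℝ ∞ (fun z ↦ fderiv ℝ m z (S z)) y := hm.fderiv_of_top.clm_apply hS
  set a := selfAccel (christoffelL G) S with ha_def
  set A := nab (christoffelL G) S y with hA
  have hAS : A (S y) = a y := rfl
  -- `b` is the `G`-adjoint of `A` applied to `a`. It represents the term `g(A w, a)` of `L_X Γ` as
  -- a vector, and satisfies `L(b) = g(a, A S) = a²`.
  let b : E := (G y).inverse (G y (a y) ∘L A)
  have hb : ∀ w, G y b w = G y (a y) (A w) := fun w ↦ by
    simp only [b, hi.self_apply_inverse, ContinuousLinearMap.comp_apply]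
  have key : fderiv ℝ (nab (christoffelL G) a) y (X y)
      = fderiv ℝ X y ∘L nab (christoffelL G) a y - nab (christoffelL G) a y ∘L fderiv ℝ X y
        + ((2 * m y) • nab (christoffelL G) a y + (2 • fderiv ℝ m y).smulRight (a y)
          + (fderiv ℝ m y (S y) • A
            + (fderiv ℝ (fun z ↦ fderiv ℝ m z (S z)) y).smulRight (S y)))
        + ((fderiv ℝ h y (a y) • L y + h y • (G y (a y) ∘L A)
              + h y • G y (A (a y))).smulRight (S y)
            + (h y • L y).smulRight (A (a y) - b)) := by
    ext u
    have hc : lieConn X (christoffelL G) y u (a y)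
        = (fderiv ℝ h y (a y) * L y u + h y * G y (a y) (A u) + h y * G y (A (a y)) u) • S y
          + (h y * L y u) • (A (a y) - b) := by
      refine H.eq_of_bilin_eq fun w ↦ ?_
      rw [H.bilin_lieConn_eq, H.form_accel]
      simp only [map_add, map_sub, map_smul, add_apply, sub_apply, smul_apply, smul_eq_mul,
        H.sharp_eq.self_of_nhds, hb]
      rw [← hA, H.symm.self_of_nhds (A u) (a y), H.symm.self_of_nhds (A w) (a y)]
      ring
    rw [fderiv_nab_along H.smooth_connection H.smooth_field.self_of_nhds ha,
      nab_congr (H.eventually.mono fun z hz ↦ hz.bracket_accel),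
      nab_add ((hm.differentiableAt_of_top.const_mul 2).fun_smul ha.differentiableAt_of_top)
        (hmS.differentiableAt_of_top.fun_smul hS.differentiableAt_of_top),
      nab_smul (hm.differentiableAt_of_top.const_mul 2) ha.differentiableAt_of_top,
      nab_smul hmS.differentiableAt_of_top hS.differentiableAt_of_top,
      fderiv_const_mul hm.differentiableAt_of_top, hc]
    simp [hA, two_smul, two_mul]
  rw [fderiv_traceL (contDiffAt_nab H.smooth_connection ha).differentiableAt_of_top, key]
  have hLb : L y b = G y (a y) (a y) := by
    rw [← H.bilin_sharp, hb, hAS]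
  simp only [map_add, map_sub, map_smul, traceL_smulRight, traceL_comp_comm (fderiv ℝ X y),
    add_apply, smul_apply, smul_eq_mul, H.null.self_of_nhds, H.bilin_sharp,
    ContinuousLinearMap.comp_apply, hAS, hLb]
  have hLA : L y (A (a y)) = 0 := H.form_nab _
  have hLa : L y (a y) = 0 := H.form_accel
  rw [hLA, nsmul_eq_mul]
  push_cast
  ring

/-- The derivative of `Ric(S, S)` along a Kerr-Schild field. -/
theorem fderiv_bochner :
    fderiv ℝ (bochner (christoffelL G) S) y (X y)
      = 2 * m y * bochner (christoffelL G) S y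
        - 2 * h y * G y (selfAccel (christoffelL G) S y) (selfAccel (christoffelL G) S y) := by
  have hm := H.smooth_m.self_of_nhds
  have hS := H.smooth_sharp.self_of_nhds
  have hX := H.smooth_field.self_of_nhds
  have hA := H.smooth_nab
  have hT : ∀ {B : E → E →L[ℝ] E}, ContDiffAt ℝ ∞ B y →
      ContDiffAt ℝ ∞ (fun z ↦ traceL E (B z)) y := fun hB ↦
    (traceL E).contDiff.contDiffAt.comp y hB
  have hq := hT hA
  have ha := hT (contDiffAt_nab H.smooth_connection H.smooth_accel)
  have hAA := hA.clm_comp hA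
  set q : E → ℝ := fun z ↦ traceL E (nab (christoffelL G) S z) with hq_def
  have hqS : ContDiffAt ℝ ∞ (fun z ↦ fderiv ℝ q z (S z)) y := hq.fderiv_of_top.clm_apply hS
  have hmS : ContDiffAt ℝ ∞ (fun z ↦ fderiv ℝ m z (S z)) y := hm.fderiv_of_top.clm_apply hS
  -- Commute the derivatives: `X(S q) = S(X q) + [X, S] q`, with `X q` known on a neighbourhood by
  -- `fderiv_div_sharp`.
  have e2 : fderiv ℝ (fun z ↦ fderiv ℝ q z (S z)) y (X y)
      = fderiv ℝ m y (S y) * q y + 2 * m y * fderiv ℝ q y (S y)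
        + fderiv ℝ (fun z ↦ fderiv ℝ m z (S z)) y (S y) := by
    have h1 := fderiv_apply_vec hq.fderiv_of_top.differentiableAt_of_top
      hS.differentiableAt_of_top (X y)
    have h2 := fderiv_apply_vec hq.fderiv_of_top.differentiableAt_of_top
      hX.differentiableAt_of_top (S y)
    have h3 : (fun z ↦ fderiv ℝ q z (X z)) =ᶠ[nhds y] fun z ↦ m z * q z + fderiv ℝ m z (S z) :=
      H.eventually.mono fun z hz ↦ hz.fderiv_div_sharp
    rw [h3.fderiv_eq, fderiv_fun_add (hm.differentiableAt_of_top.fun_mul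
      hq.differentiableAt_of_top) hmS.differentiableAt_of_top,
      fderiv_fun_mul hm.differentiableAt_of_top hq.differentiableAt_of_top] at h2
    simp only [add_apply, smul_apply, smul_eq_mul] at h2
    have h4 : fderiv ℝ S y (X y) = fderiv ℝ X y (S y) + m y • S y := by
      rw [← H.bracket_sharp, bracket]
      abel
    rw [h1, h4, map_add, map_smul, smul_eq_mul, hq.fderiv_fderiv_symm (X y)]
    linarith
  -- The only term where `h` survives: the part `h g(a, ·) ⊗ S` of `L_X ∇S`, composed with `A`, has
  -- trace `h g(a, A S) = h a²`, and the square doubles it.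
  have e3 : fderiv ℝ (fun z ↦ traceL E (nab (christoffelL G) S z ∘L nab (christoffelL G) S z))
      y (X y) = 2 * m y * traceL E (nab (christoffelL G) S y ∘L nab (christoffelL G) S y)
        + 2 * fderiv ℝ m y (selfAccel (christoffelL G) S y)
        + 2 * h y * G y (selfAccel (christoffelL G) S y) (selfAccel (christoffelL G) S y) := by
    rw [fderiv_traceL hAA.differentiableAt_of_top,
      (hA.differentiableAt_of_top.hasFDerivAt.clm_comp
        hA.differentiableAt_of_top.hasFDerivAt).fderiv]
    have h1 : ∀ B : E →L[ℝ] E, traceL E (B ∘L nab (christoffelL G) S y)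
        = traceL E (nab (christoffelL G) S y ∘L B) := fun B ↦ traceL_comp_comm _ _
    have hsr : ∀ (f : E →L[ℝ] ℝ) (v : E), nab (christoffelL G) S y ∘L f.smulRight v
        = f.smulRight (nab (christoffelL G) S y v) := fun f v ↦ by ext; simp
    have h2 : traceL E (nab (christoffelL G) S y ∘L (fderiv ℝ X y ∘L nab (christoffelL G) S y))
        = traceL E (nab (christoffelL G) S y ∘L (nab (christoffelL G) S y ∘L fderiv ℝ X y)) := by
      rw [← ContinuousLinearMap.comp_assoc, h1]
    have h3 : traceL E (nab (christoffelL G) S y ∘L fderiv ℝ (nab (christoffelL G) S) y (X y))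
        = m y * traceL E (nab (christoffelL G) S y ∘L nab (christoffelL G) S y)
          + fderiv ℝ m y (selfAccel (christoffelL G) S y)
          + h y * G y (selfAccel (christoffelL G) S y) (selfAccel (christoffelL G) S y) := by
      rw [H.fderiv_nab_sharp]
      simp only [ContinuousLinearMap.comp_add, ContinuousLinearMap.comp_sub,
        ContinuousLinearMap.comp_smul, hsr, map_add, map_sub, map_smul, traceL_smulRight, h2,
        add_apply, smul_apply, smul_eq_mul, H.form_nab]
      simp only [selfAccel]
      ring
    simp only [add_apply, map_add, ContinuousLinearMap.comp_apply,
      ContinuousLinearMap.compL_apply, ContinuousLinearMap.flip_apply, h1, h3]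
    ring
  have hsum : fderiv ℝ (bochner (christoffelL G) S) y (X y)
      = fderiv ℝ (fun z ↦ traceL E (nab (christoffelL G) (selfAccel (christoffelL G) S) z)) y (X y)
        - fderiv ℝ (fun z ↦ fderiv ℝ q z (S z)) y (X y)
        - fderiv ℝ (fun z ↦ traceL E (nab (christoffelL G) S z ∘L nab (christoffelL G) S z))
            y (X y) := by
    have := fderiv_fun_sub (ha.differentiableAt_of_top.fun_sub hqS.differentiableAt_of_top)
      (hT hAA).differentiableAt_of_top
    rw [fderiv_fun_sub ha.differentiableAt_of_top hqS.differentiableAt_of_top] at this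
    exact congrArg (fun T : E →L[ℝ] ℝ ↦ T (X y)) this
  -- The terms `2 a(m)`, `S(m) div S` and `S(S(m))` cancel between the three pieces.
  rw [hsum, e2, e3, H.fderiv_div_accel, bochner]
  ring

/-- `Ric(S, S) / a²` changes along a Kerr-Schild field in such a way that `L_X γ = 0`. -/
theorem fderiv_bochner_div_accelSq
    (h0 : G y (selfAccel (christoffelL G) S y) (selfAccel (christoffelL G) S y) ≠ 0) :
    fderiv ℝ (fun z ↦ bochner (christoffelL G) S z
        / G z (selfAccel (christoffelL G) S z) (selfAccel (christoffelL G) S z)) y (X y)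
      = -2 * m y * (bochner (christoffelL G) S y
          / G y (selfAccel (christoffelL G) S y) (selfAccel (christoffelL G) S y)) - 2 * h y := by
  have hb := (contDiffAt_bochner H.smooth_connection
    H.smooth_sharp.self_of_nhds).differentiableAt_of_top
  have ha := H.smooth_accel.differentiableAt_of_top
  have hq := (H.smooth_metric.self_of_nhds.differentiableAt_of_top.clm_apply ha).clm_apply ha
  have hinv : HasFDerivAt (fun z ↦ (G z (selfAccel (christoffelL G) S z)
      (selfAccel (christoffelL G) S z))⁻¹) _ y :=
    (hasDerivAt_inv h0).comp_hasFDerivAt y hq.hasFDerivAt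
  simp only [div_eq_mul_inv]
  rw [(hb.hasFDerivAt.fun_mul hinv).fderiv]
  simp only [add_apply, smul_apply, smul_eq_mul, H.fderiv_bochner, H.fderiv_accelSq]
  field_simp
  ring

end KerrSchildNear

end Model

section Charts

variable {E : Type*} [NormedAddCommGroup E] [NormedSpace ℝ E]
  {M : Type*} [TopologicalSpace M] [ChartedSpace E M]

/-! ### Changes of charts -/

/-- The differential of the inverse of the chart around `x₀`, as an endomorphism of `E`. -/
noncomputable def symmDeriv (x₀ : M) (y : E) : E →L[ℝ] E :=
  mfderiv 𝓘(ℝ, E) 𝓘(ℝ, E) (extChartAt 𝓘(ℝ, E) x₀).symm y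

/-- The transition map from the chart around `x₀` to the chart around `x₁`. -/
noncomputable def transition (x₀ x₁ : M) (y : E) : E :=
  extChartAt 𝓘(ℝ, E) x₁ ((extChartAt 𝓘(ℝ, E) x₀).symm y)

/-- A vector field, with tangent spaces identified with the model space. -/
def vfieldFun (X : VField E M) : M → E := X

/-- A 1-form field, with tangent spaces identified with the model space. -/
def formFun (ℓ : Form E M) : M → E →L[ℝ] ℝ := ℓ

/-- A 2-covariant tensor field, with tangent spaces identified with the model space. -/
def bilinFun (g : Bilin E M) : M → E →L[ℝ] E →L[ℝ] ℝ := g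

theorem formInChart_eq (x₀ : M) (ℓ : Form E M) (y u : E) :
    formInChart x₀ ℓ y u
      = formFun ℓ ((extChartAt 𝓘(ℝ, E) x₀).symm y) (symmDeriv x₀ y u) := rfl

theorem bilinInChart_eq (x₀ : M) (g : Bilin E M) (y u v : E) :
    bilinInChart x₀ g y u v
      = bilinFun g ((extChartAt 𝓘(ℝ, E) x₀).symm y)
          (symmDeriv x₀ y u) (symmDeriv x₀ y v) := rfl

theorem vfieldInChart_eq (x₀ : M) (X : VField E M) (y : E) :
    vfieldInChart x₀ X y
      = (symmDeriv x₀ y).inverse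
          (vfieldFun X ((extChartAt 𝓘(ℝ, E) x₀).symm y)) := rfl

variable [IsManifold 𝓘(ℝ, E) ∞ M]

variable (E M) in
theorem isManifold_one : IsManifold 𝓘(ℝ, E) 1 M := .of_le (n := ∞) (by simp)

theorem isInvertible_symmDeriv {x₀ : M} {y : E} (hy : y ∈ (extChartAt 𝓘(ℝ, E) x₀).target) :
    (symmDeriv x₀ y).IsInvertible := by
  have := isManifold_one E M
  have h := isInvertible_mfderivWithin_extChartAt_symm (I := 𝓘(ℝ, E)) hy
  rw [modelWithCornersSelf_coe, Set.range_id, mfderivWithin_univ] at h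
  exact h

/-- The tangent space at `x` is identified with `E` by the preferred chart at `x`. At the centre of
a chart, coordinate expressions are therefore the tensors themselves. -/
theorem symmDeriv_self (x : M) :
    symmDeriv x (extChartAt 𝓘(ℝ, E) x x) = .id ℝ E := by
  have := isManifold_one E M
  have h := mfderivWithin_range_extChartAt_symm (I := 𝓘(ℝ, E)) (x := x)
  rw [modelWithCornersSelf_coe, Set.range_id, mfderivWithin_univ] at h
  exact h

theorem chartDeriv_eq_id (x : M) : chartDeriv (E := E) x = ContinuousLinearMap.id ℝ E := by
  have := isManifold_one E M
  exact mfderiv_extChartAt_self (I := 𝓘(ℝ, E)) (x := x)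

theorem bilinInChart_self (x : M) (g : Bilin E M) :
    bilinInChart x g (extChartAt 𝓘(ℝ, E) x x) = bilinFun g x := by
  ext u v
  rw [bilinInChart_eq, symmDeriv_self, extChartAt_to_inv]
  rfl

theorem formInChart_self (x : M) (ℓ : Form E M) :
    formInChart x ℓ (extChartAt 𝓘(ℝ, E) x x) = formFun ℓ x := by
  ext u
  rw [formInChart_eq, symmDeriv_self, extChartAt_to_inv]
  rfl

theorem vfieldInChart_self (x : M) (X : VField E M) :
    vfieldInChart x X (extChartAt 𝓘(ℝ, E) x x) = vfieldFun X x := by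
  rw [vfieldInChart_eq, symmDeriv_self, extChartAt_to_inv, ContinuousLinearMap.inverse_id]
  rfl

section Transition

variable {x₀ x₁ : M} {y : E} (hy : y ∈ (extChartAt 𝓘(ℝ, E) x₀).target)
  (hx : (extChartAt 𝓘(ℝ, E) x₀).symm y ∈ (extChartAt 𝓘(ℝ, E) x₁).source)
include hy

theorem contMDiffAt_extChartAt_symm :
    ContMDiffAt 𝓘(ℝ, E) 𝓘(ℝ, E) ∞ (extChartAt 𝓘(ℝ, E) x₀).symm y :=
  (contMDiffOn_extChartAt_symm x₀).contMDiffAt ((isOpen_extChartAt_target x₀).mem_nhds hy)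

include hx

theorem eventually_mem_transition :
    ∀ᶠ z in nhds y, z ∈ (extChartAt 𝓘(ℝ, E) x₀).target ∧
      (extChartAt 𝓘(ℝ, E) x₀).symm z ∈ (extChartAt 𝓘(ℝ, E) x₁).source :=
  (show ∀ᶠ z in nhds y, z ∈ (extChartAt 𝓘(ℝ, E) x₀).target from
    (isOpen_extChartAt_target x₀).mem_nhds hy).and
    ((contMDiffAt_extChartAt_symm hy).continuousAt.eventually
      ((isOpen_extChartAt_source x₁).mem_nhds hx))

theorem contDiffAt_transition : ContDiffAt ℝ ∞ (transition x₀ x₁) y := by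
  rw [← contMDiffAt_iff_contDiffAt]
  exact (contMDiffAt_extChartAt' (by simpa using hx)).comp y (contMDiffAt_extChartAt_symm hy)

omit [IsManifold 𝓘(ℝ, E) ∞ M] hy in
theorem transition_mem : transition x₀ x₁ y ∈ (extChartAt 𝓘(ℝ, E) x₁).target :=
  (extChartAt 𝓘(ℝ, E) x₁).map_source hx

omit [IsManifold 𝓘(ℝ, E) ∞ M] hy in
theorem symm_transition : (extChartAt 𝓘(ℝ, E) x₁).symm (transition x₀ x₁ y)
    = (extChartAt 𝓘(ℝ, E) x₀).symm y :=
  (extChartAt 𝓘(ℝ, E) x₁).left_inv hx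

theorem symmDeriv_transition :
    symmDeriv x₀ y = symmDeriv x₁ (transition x₀ x₁ y) ∘L fderiv ℝ (transition x₀ x₁) y := by
  have h1 : (extChartAt 𝓘(ℝ, E) x₁).symm ∘ transition x₀ x₁ =ᶠ[nhds y]
      (extChartAt 𝓘(ℝ, E) x₀).symm := by
    filter_upwards [eventually_mem_transition hy hx] with z hz
    exact symm_transition hz.2
  have h2 := mfderiv_comp (I := 𝓘(ℝ, E)) (I' := 𝓘(ℝ, E)) (I'' := 𝓘(ℝ, E)) y
    ((contMDiffAt_extChartAt_symm (transition_mem hx)).mdifferentiableAt (by simp))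
    ((contDiffAt_transition hy hx).contMDiffAt.mdifferentiableAt (by simp))
  rw [mfderiv_eq_fderiv] at h2
  have h3 := h1.mfderiv_eq (I := 𝓘(ℝ, E)) (I' := 𝓘(ℝ, E))
  exact (h3.symm.trans h2 :)

theorem isInvertible_fderiv_transition : (fderiv ℝ (transition x₀ x₁) y).IsInvertible := by
  have h1 := isInvertible_symmDeriv (transition_mem hx)
  have h2 : fderiv ℝ (transition x₀ x₁) y
      = (symmDeriv x₁ (transition x₀ x₁ y)).inverse ∘L symmDeriv x₀ y := by
    rw [symmDeriv_transition hy hx, ← ContinuousLinearMap.comp_assoc, h1.inverse_comp_self,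
      ContinuousLinearMap.id_comp]
  rw [h2]
  exact h1.inverse.comp (isInvertible_symmDeriv hy)

theorem bilinInChart_transition (g : Bilin E M) (u v : E) :
    bilinInChart x₀ g y u v = bilinInChart x₁ g (transition x₀ x₁ y)
      (fderiv ℝ (transition x₀ x₁) y u) (fderiv ℝ (transition x₀ x₁) y v) := by
  rw [bilinInChart_eq, bilinInChart_eq, symm_transition hx, symmDeriv_transition hy hx]
  rfl

theorem formInChart_transition (ℓ : Form E M) (u : E) :
    formInChart x₀ ℓ y u = formInChart x₁ ℓ (transition x₀ x₁ y)
      (fderiv ℝ (transition x₀ x₁) y u) := by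
  rw [formInChart_eq, formInChart_eq, symm_transition hx, symmDeriv_transition hy hx]
  rfl

theorem vfieldInChart_transition (X : VField E M) :
    fderiv ℝ (transition x₀ x₁) y (vfieldInChart x₀ X y)
      = vfieldInChart x₁ X (transition x₀ x₁ y) := by
  have h1 := isInvertible_symmDeriv (transition_mem hx)
  rw [vfieldInChart_eq, vfieldInChart_eq, symm_transition hx]
  refine h1.injective ?_
  rw [h1.self_apply_inverse, ← ContinuousLinearMap.comp_apply, ← symmDeriv_transition hy hx,
    (isInvertible_symmDeriv hy).self_apply_inverse]

end Transition

/-! ### Smoothness in charts -/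

theorem contMDiffAt_comp_extChartAt_iff {F : Type*} [NormedAddCommGroup F] [NormedSpace ℝ F]
    {f : E → F} {x₀ x : M} (hx : x ∈ (extChartAt 𝓘(ℝ, E) x₀).source) :
    ContMDiffAt 𝓘(ℝ, E) 𝓘(ℝ, F) ∞ (fun z ↦ f (extChartAt 𝓘(ℝ, E) x₀ z)) x ↔
      ContDiffAt ℝ ∞ f (extChartAt 𝓘(ℝ, E) x₀ x) := by
  have hy := (extChartAt 𝓘(ℝ, E) x₀).map_source hx
  constructor
  · intro h
    rw [← contMDiffAt_iff_contDiffAt]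
    rw [← (extChartAt 𝓘(ℝ, E) x₀).left_inv hx] at h
    refine (h.comp _ (contMDiffAt_extChartAt_symm hy)).congr_of_eventuallyEq ?_
    filter_upwards [(isOpen_extChartAt_target x₀).mem_nhds hy] with z hz
    rw [Function.comp_apply, (extChartAt 𝓘(ℝ, E) x₀).right_inv hz]
  · intro h
    exact h.contMDiffAt.comp x (contMDiffAt_extChartAt' (by simpa using hx))

theorem contDiffAt_comp_symm {F : Type*} [NormedAddCommGroup F] [NormedSpace ℝ F]
    {f : M → F} {x₀ x : M} (hx : x ∈ (extChartAt 𝓘(ℝ, E) x₀).source)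
    (hf : ContMDiffAt 𝓘(ℝ, E) 𝓘(ℝ, F) ∞ f x) :
    ContDiffAt ℝ ∞ (fun z ↦ f ((extChartAt 𝓘(ℝ, E) x₀).symm z)) (extChartAt 𝓘(ℝ, E) x₀ x) := by
  rw [← contMDiffAt_comp_extChartAt_iff hx]
  refine hf.congr_of_eventuallyEq ?_
  filter_upwards [(isOpen_extChartAt_source x₀).mem_nhds hx] with z hz
  rw [(extChartAt 𝓘(ℝ, E) x₀).left_inv hz]

theorem symmL_eq_symmDeriv {x₀ x : M} (hx : x ∈ (extChartAt 𝓘(ℝ, E) x₀).source) :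
    Trivialization.symmL ℝ (trivializationAt E (TangentSpace 𝓘(ℝ, E)) x₀) x
      = symmDeriv x₀ (extChartAt 𝓘(ℝ, E) x₀ x) := by
  have := isManifold_one E M
  have h := TangentBundle.symmL_trivializationAt (I := 𝓘(ℝ, E)) (x₀ := x₀) (x := x)
    (by simpa using hx)
  rw [modelWithCornersSelf_coe, Set.range_id, mfderivWithin_univ] at h
  exact h

/-- Read in the bundle trivialization at `x₀`, the section is `formInChart`: the inverse of the
tangent trivialization is the differential of the inverse chart. -/
theorem contMDiffAt_form_iff {ℓ : Form E M} {x₀ x : M}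
    (hx : x ∈ (extChartAt 𝓘(ℝ, E) x₀).source) :
    ContMDiffAt 𝓘(ℝ, E) (𝓘(ℝ, E).prod 𝓘(ℝ, E →L[ℝ] ℝ)) ∞
      (fun x ↦ TotalSpace.mk' (E →L[ℝ] ℝ)
        (E := fun x : M ↦ TangentSpace 𝓘(ℝ, E) x →L[ℝ] Bundle.Trivial M ℝ x) x (ℓ x)) x ↔
      ContDiffAt ℝ ∞ (formInChart x₀ ℓ) (extChartAt 𝓘(ℝ, E) x₀ x) := by
  have hb : x ∈ (trivializationAt (E →L[ℝ] ℝ)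
      (fun x : M ↦ TangentSpace 𝓘(ℝ, E) x →L[ℝ] Bundle.Trivial M ℝ x) x₀).baseSet := by
    simpa [hom_trivializationAt_baseSet] using hx
  refine (Trivialization.contMDiffAt_section_iff _ hb).trans ?_
  rw [← contMDiffAt_comp_extChartAt_iff hx]
  refine Filter.EventuallyEq.contMDiffAt_iff ?_
  filter_upwards [(isOpen_extChartAt_source x₀).mem_nhds hx] with z hz
  ext v
  rw [formInChart_eq, (extChartAt 𝓘(ℝ, E) x₀).left_inv hz, ← symmL_eq_symmDeriv hz,
    hom_trivializationAt_apply, ContinuousLinearMap.inCoordinates]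
  simp
  rfl

set_option synthInstance.maxHeartbeats 200000 in
theorem contMDiffAt_bilin_iff {g : Bilin E M} {x₀ x : M}
    (hx : x ∈ (extChartAt 𝓘(ℝ, E) x₀).source) :
    ContMDiffAt 𝓘(ℝ, E) (𝓘(ℝ, E).prod 𝓘(ℝ, E →L[ℝ] E →L[ℝ] ℝ)) ∞
      (fun x ↦ TotalSpace.mk' (E →L[ℝ] E →L[ℝ] ℝ)
        (E := fun x : M ↦ TangentSpace 𝓘(ℝ, E) x →L[ℝ] TangentSpace 𝓘(ℝ, E) x →L[ℝ]
          Bundle.Trivial M ℝ x) x (g x)) x ↔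
      ContDiffAt ℝ ∞ (bilinInChart x₀ g) (extChartAt 𝓘(ℝ, E) x₀ x) := by
  have hb : x ∈ (trivializationAt (E →L[ℝ] E →L[ℝ] ℝ)
      (fun x : M ↦ TangentSpace 𝓘(ℝ, E) x →L[ℝ] TangentSpace 𝓘(ℝ, E) x →L[ℝ]
        Bundle.Trivial M ℝ x) x₀).baseSet := by
    simpa [hom_trivializationAt_baseSet] using hx
  refine (Trivialization.contMDiffAt_section_iff _ hb).trans ?_
  rw [← contMDiffAt_comp_extChartAt_iff hx]
  refine Filter.EventuallyEq.contMDiffAt_iff ?_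
  filter_upwards [(isOpen_extChartAt_source x₀).mem_nhds hx] with z hz
  ext u v
  rw [bilinInChart_eq, (extChartAt 𝓘(ℝ, E) x₀).left_inv hz, ← symmL_eq_symmDeriv hz]
  rw [hom_trivializationAt_apply, ContinuousLinearMap.inCoordinates]
  simp only [ContinuousLinearMap.comp_apply, Trivialization.continuousLinearMapAt_apply]
  have hz' : z ∈ (trivializationAt (E →L[ℝ] ℝ)
      (fun x : M ↦ TangentSpace 𝓘(ℝ, E) x →L[ℝ] Bundle.Trivial M ℝ x) x₀).baseSet := by
    simpa [hom_trivializationAt_baseSet] using hz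
  -- The fibre of the target is itself a space of 1-forms, so the hom-bundle trivialization is
  -- unfolded a second time.
  rw [Trivialization.coe_linearMapAt_of_mem _ hz']
  beta_reduce
  rw [hom_trivializationAt_apply, ContinuousLinearMap.inCoordinates]
  simp
  rfl

theorem contMDiffAt_vfield_iff {X : VField E M} {x₀ x : M}
    (hx : x ∈ (extChartAt 𝓘(ℝ, E) x₀).source) :
    ContMDiffAt 𝓘(ℝ, E) (𝓘(ℝ, E).prod 𝓘(ℝ, E)) ∞
      (fun x ↦ (TotalSpace.mk' E x (X x) : TangentBundle 𝓘(ℝ, E) M)) x ↔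
      ContDiffAt ℝ ∞ (vfieldInChart x₀ X) (extChartAt 𝓘(ℝ, E) x₀ x) := by
  have hb : x ∈ (trivializationAt E (TangentSpace 𝓘(ℝ, E) : M → Type _) x₀).baseSet := by
    simpa using hx
  refine (Trivialization.contMDiffAt_section_iff _ hb).trans ?_
  rw [← contMDiffAt_comp_extChartAt_iff hx]
  refine Filter.EventuallyEq.contMDiffAt_iff ?_
  filter_upwards [(isOpen_extChartAt_source x₀).mem_nhds hx] with z hz
  have hz' : z ∈ (trivializationAt E (TangentSpace 𝓘(ℝ, E) : M → Type _) x₀).baseSet := by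
    simpa using hz
  rw [vfieldInChart_eq, (extChartAt 𝓘(ℝ, E) x₀).left_inv hz]
  refine ((isInvertible_symmDeriv ((extChartAt 𝓘(ℝ, E) x₀).map_source hz)).inverse_apply_eq.2
    ?_).symm
  have h1 := Trivialization.symmL_continuousLinearMapAt (R := ℝ) _ hz' (X z)
  rw [Trivialization.continuousLinearMapAt_apply_of_mem (R := ℝ) (hb := hz')] at h1
  exact h1.symm.trans (congrArg (fun T : E →L[ℝ] E ↦ T _) (symmL_eq_symmDeriv hz))

end Charts

/-! ### Invertibility of metrics, scaling of the Ricci tensor, and the Lie derivative of `G + f L ⊗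
L`. -/

section Model

variable {E : Type*} [NormedAddCommGroup E] [NormedSpace ℝ E]

theorem isInvertible_of_nondegenerate [FiniteDimensional ℝ E] {B : E →L[ℝ] E →L[ℝ] ℝ}
    (hB : ∀ u, (∀ v, B u v = 0) → u = 0) : B.IsInvertible := by
  have hinj : Function.Injective (B : E →ₗ[ℝ] E →L[ℝ] ℝ) := by
    rw [injective_iff_map_eq_zero]
    exact fun u hu ↦ hB u fun v ↦ congrArg (fun T : E →L[ℝ] ℝ ↦ T v) hu
  have hdim : Module.finrank ℝ E = Module.finrank ℝ (E →L[ℝ] ℝ) :=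
    (Subspace.dual_finrank_eq (K := ℝ) (V := E)).symm.trans
      (LinearMap.toContinuousLinearMap (𝕜 := ℝ) (E := E) (F' := ℝ)).finrank_eq
  exact ⟨((B : E →ₗ[ℝ] E →L[ℝ] ℝ).linearEquivOfInjective hinj hdim).toContinuousLinearEquiv, by
    ext u v; simp⟩

/-- The Ricci tensor depends only on the vectors at `y`, so a constant `c` suffices even when it is
the value of a rescaling function. -/
theorem ricciModel_smul_smul [FiniteDimensional ℝ E] {G : E → E →L[ℝ] E →L[ℝ] ℝ} (y w : E)
    (c : ℝ) : ricciModel G y (c • w) (c • w) = c ^ 2 * ricciModel G y w w := by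
  have h1 : ∀ z u v, christoffel G z u (c • v) = c • christoffel G z u v := fun z u v ↦ by
    simp only [← christoffelL_apply, map_smul]
  have h2 : ∀ z u v, christoffel G z (c • u) v = c • christoffel G z u v := fun z u v ↦ by
    simp only [← christoffelL_apply, map_smul, smul_apply]
  rw [ricciModel, ricciModel, Finset.mul_sum]
  refine Finset.sum_congr rfl fun i _ ↦ ?_
  rw [← smul_eq_mul, ← map_smul]
  congr 1
  have h3 : ∀ f : E → E, fderiv ℝ (fun z ↦ c • f z) y = c • fderiv ℝ f y := fun f ↦
    congrFun (fderiv_const_smul_field (f := f) c) y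
  simp only [curvature, h1, h2, h3, map_smul, smul_apply]
  module

/-- The Lie derivative of `G + f L ⊗ L`. -/
theorem lieBilinModel_add_smul_sq {X : E → E} {G G' : E → E →L[ℝ] E →L[ℝ] ℝ}
    {L : E → E →L[ℝ] ℝ} {f : E → ℝ} {y : E} (hG : DifferentiableAt ℝ G y)
    (hL : DifferentiableAt ℝ L y) (hf : DifferentiableAt ℝ f y)
    (hG' : ∀ᶠ z in nhds y, G' z = G z + f z • (L z).smulRight (L z)) (u v : E) :
    lieBilinModel X G' y u v = lieBilinModel X G y u v + fderiv ℝ f y (X y) * (L y u * L y v)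
      + f y * (lieFormModel X L y u * L y v + L y u * lieFormModel X L y v) := by
  have hsq : DifferentiableAt ℝ (fun z ↦ (L z).smulRight (L z)) y :=
    (ContinuousLinearMap.smulRightL ℝ E (E →L[ℝ] ℝ)).isBoundedBilinearMap.contDiff
      |>.differentiable one_ne_zero |>.differentiableAt |>.comp y (hL.prodMk hL)
  have hLc : ∀ a, DifferentiableAt ℝ (fun z ↦ L z a) y := fun a ↦
    hL.clm_apply (differentiableAt_const a)
  have hd : fderiv ℝ (fun z ↦ (L z).smulRight (L z)) y (X y) u v
      = fderiv ℝ L y (X y) u * L y v + L y u * fderiv ℝ L y (X y) v := by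
    have h1 := fderiv_bilin_apply hsq (differentiableAt_const u) (differentiableAt_const v) (X y)
    simp only [ContinuousLinearMap.smulRight_apply, smul_apply, smul_eq_mul, fderiv_fun_const,
      Pi.zero_apply, zero_apply, map_zero, add_zero] at h1
    rw [← h1, fderiv_fun_mul (hLc u) (hLc v)]
    simp only [add_apply, smul_apply, smul_eq_mul, fderiv_apply_const hL]
    ring
  have hD : fderiv ℝ G' y (X y) u v = fderiv ℝ G y (X y) u v
      + fderiv ℝ f y (X y) * (L y u * L y v)
      + f y * (fderiv ℝ L y (X y) u * L y v + L y u * fderiv ℝ L y (X y) v) := by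
    rw [Filter.EventuallyEq.fderiv_eq hG', fderiv_fun_add hG (hf.fun_smul hsq),
      fderiv_fun_smul hf hsq, ← hd]
    simp
    ring
  rw [lieBilinModel_apply, lieBilinModel_apply, hD, hG'.self_of_nhds]
  simp [lieFormModel]
  ring

end Model

section Manifold

variable {E : Type*} [NormedAddCommGroup E] [NormedSpace ℝ E]
  {M : Type*} [TopologicalSpace M] [ChartedSpace E M] [IsManifold 𝓘(ℝ, E) ∞ M]
  {g : Bilin E M} {ℓ : Form E M} {X : VField E M} {x₀ x : M} {y : E}

/-! ### Null 1-forms in charts -/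

theorem SmoothBilin.contDiffAt (hg : SmoothBilin g)
    (hy : y ∈ (extChartAt 𝓘(ℝ, E) x₀).target) : ContDiffAt ℝ ∞ (bilinInChart x₀ g) y := by
  have h := (contMDiffAt_bilin_iff ((extChartAt 𝓘(ℝ, E) x₀).map_target hy)).1 (hg _)
  rwa [(extChartAt 𝓘(ℝ, E) x₀).right_inv hy] at h

theorem SmoothForm.contDiffAt (hℓ : SmoothForm ℓ)
    (hy : y ∈ (extChartAt 𝓘(ℝ, E) x₀).target) : ContDiffAt ℝ ∞ (formInChart x₀ ℓ) y := by
  have h := (contMDiffAt_form_iff ((extChartAt 𝓘(ℝ, E) x₀).map_target hy)).1 (hℓ _)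
  rwa [(extChartAt 𝓘(ℝ, E) x₀).right_inv hy] at h

theorem SmoothVFieldOn.contDiffAt {U : Set M} (hX : SmoothVFieldOn X U) (hU : IsOpen U)
    (hy : y ∈ (extChartAt 𝓘(ℝ, E) x₀).target) (hyU : (extChartAt 𝓘(ℝ, E) x₀).symm y ∈ U) :
    ContDiffAt ℝ ∞ (vfieldInChart x₀ X) y := by
  have h := (contMDiffAt_vfield_iff ((extChartAt 𝓘(ℝ, E) x₀).map_target hy)).1
    (hX.contMDiffAt (hU.mem_nhds hyU))
  rwa [(extChartAt 𝓘(ℝ, E) x₀).right_inv hy] at h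

omit [IsManifold 𝓘(ℝ, E) ∞ M] in
theorem eventually_mem_target (hy : y ∈ (extChartAt 𝓘(ℝ, E) x₀).target) :
    ∀ᶠ z in nhds y, z ∈ (extChartAt 𝓘(ℝ, E) x₀).target :=
  (isOpen_extChartAt_target x₀).mem_nhds hy

variable [FiniteDimensional ℝ E]

theorem IsMetric.isInvertible (hg : IsMetric g) (x : M) : (bilinFun g x).IsInvertible :=
  isInvertible_of_nondegenerate (hg.nondegenerate x)

theorem IsMetric.apply_sharp (hg : IsMetric g) (ℓ : Form E M) (x : M)
    (v : TangentSpace 𝓘(ℝ, E) x) : g x (sharp g ℓ x) v = ℓ x v :=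
  congrArg (fun T : E →L[ℝ] ℝ ↦ T v) ((hg.isInvertible x).self_apply_inverse (formFun ℓ x))

theorem IsMetric.isInvertible_inChart (hg : IsMetric g)
    (hy : y ∈ (extChartAt 𝓘(ℝ, E) x₀).target) : (bilinInChart x₀ g y).IsInvertible := by
  have hD := isInvertible_symmDeriv hy
  refine isInvertible_of_nondegenerate fun u hu ↦ ?_
  refine hD.injective ?_
  rw [map_zero]
  refine hg.nondegenerate ((extChartAt 𝓘(ℝ, E) x₀).symm y) _ fun v ↦ ?_
  obtain ⟨w, rfl⟩ := hD.surjective v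
  exact hu w

theorem formInChart_eq_sharp (hg : IsMetric g) (ℓ : Form E M)
    (hy : y ∈ (extChartAt 𝓘(ℝ, E) x₀).target) :
    bilinInChart x₀ g y (vfieldInChart x₀ (sharp g ℓ) y) = formInChart x₀ ℓ y := by
  ext u
  rw [bilinInChart_eq, vfieldInChart_eq, (isInvertible_symmDeriv hy).self_apply_inverse]
  exact hg.apply_sharp ℓ _ _

theorem nullFormNear (hg : IsMetric g) (hℓ : SmoothForm ℓ) (hnull : IsNull g ℓ)
    (hy : y ∈ (extChartAt 𝓘(ℝ, E) x₀).target) :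
    NullFormNear (bilinInChart x₀ g) (formInChart x₀ ℓ) (vfieldInChart x₀ (sharp g ℓ)) y := by
  have hn := eventually_mem_target hy
  refine ⟨?_, ?_, ?_, ?_, ?_, ?_, ?_⟩
  · exact hn.mono fun z hz ↦ hg.smooth.contDiffAt hz
  · exact hn.mono fun z hz ↦ hℓ.contDiffAt hz
  · refine hn.mono fun z hz ↦ ?_
    have h1 := ((hg.smooth.contDiffAt hz).clm_inverse (hg.isInvertible_inChart hz)).clm_apply
      (hℓ.contDiffAt hz)
    -- Near `z` the chart expression of the sharp is the inverse of the metric matrix applied to the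
    -- form, hence smooth.
    refine h1.congr_of_eventuallyEq ((eventually_mem_target hz).mono fun w hw ↦ ?_)
    exact ((hg.isInvertible_inChart hw).inverse_apply_eq.2
      (formInChart_eq_sharp hg ℓ hw).symm).symm
  · exact Filter.Eventually.of_forall fun z u v ↦ hg.symm _ _ _
  · exact hn.mono fun z hz ↦ hg.isInvertible_inChart hz
  · exact hn.mono fun z hz ↦ formInChart_eq_sharp hg ℓ hz
  · refine hn.mono fun z hz ↦ ?_
    rw [formInChart_eq, vfieldInChart_eq, (isInvertible_symmDeriv hz).self_apply_inverse]
    exact (hg.apply_sharp ℓ _ _).symm.trans (hnull _)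

/-! ### Acceleration and Ricci curvature in charts -/

/-- The acceleration of `ℓ` in the chart around `x₀`. -/
noncomputable def accelInChart (g : Bilin E M) (ℓ : Form E M) (x₀ : M) : E → E :=
  selfAccel (christoffelL (bilinInChart x₀ g)) (vfieldInChart x₀ (sharp g ℓ))

omit [FiniteDimensional ℝ E] in
theorem covDeriv_eq_nab (X : VField E M) (x : M) :
    vfieldFun (covDeriv g X X) x
      = selfAccel (christoffelL (bilinInChart x g)) (vfieldInChart x X)
        (extChartAt 𝓘(ℝ, E) x x) := by
  rw [selfAccel, nab_apply, christoffelL_apply]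
  have : ∀ v : E, (chartDeriv (E := E) x).inverse v = v := fun v ↦ by
    rw [chartDeriv_eq_id]
    exact congrArg (fun T : E →L[ℝ] E ↦ T v) ContinuousLinearMap.inverse_id
  exact this _

/-- By definition both scalars at a point are computed in the preferred chart of that point, which
moves with it. Naturality under the transition map expresses them in one fixed chart, where they can
be differentiated. -/
theorem accelSq_ricciBar_inChart (hg : IsMetric g) (hℓ : SmoothForm ℓ) (hnull : IsNull g ℓ)
    (hy : y ∈ (extChartAt 𝓘(ℝ, E) x₀).target) :
    accelSq g ℓ ((extChartAt 𝓘(ℝ, E) x₀).symm y)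
        = bilinInChart x₀ g y (accelInChart g ℓ x₀ y) (accelInChart g ℓ x₀ y) ∧
      ricciBar g ℓ ((extChartAt 𝓘(ℝ, E) x₀).symm y)
        = bochner (christoffelL (bilinInChart x₀ g)) (vfieldInChart x₀ (sharp g ℓ)) y := by
  set p := (extChartAt 𝓘(ℝ, E) x₀).symm y with hp
  have hx : (extChartAt 𝓘(ℝ, E) x₀).symm y ∈ (extChartAt 𝓘(ℝ, E) p).source :=
    mem_extChartAt_source p
  have hτ : transition x₀ p y = extChartAt 𝓘(ℝ, E) p p := rfl
  have hyp : transition x₀ p y ∈ (extChartAt 𝓘(ℝ, E) p).target := transition_mem hx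
  have ht := eventually_mem_transition hy hx
  have H := nullFormNear hg hℓ hnull hy
  have Hp := nullFormNear hg hℓ hnull hyp
  have hrel := related_bochner (φ := transition x₀ p) (y := y)
    (ht.mono fun z hz ↦ contDiffAt_transition hz.1 hz.2)
    (ht.mono fun z hz ↦ isInvertible_fderiv_transition hz.1 hz.2)
    Hp.smooth_sharp H.smooth_sharp Hp.smooth_connection H.smooth_connection
    (ht.mono fun z hz ↦ vfieldInChart_transition hz.1 hz.2 (sharp g ℓ))
    (ht.mono fun z hz ↦ related_christoffelL (contDiffAt_transition hz.1 hz.2)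
      (isInvertible_fderiv_transition hz.1 hz.2)
      (hg.smooth.contDiffAt (transition_mem hz.2)).differentiableAt_of_top
      (hg.smooth.contDiffAt hz.1).differentiableAt_of_top
      (fun u v ↦ hg.symm _ _ _)
      (hg.isInvertible_inChart (transition_mem hz.2)) (hg.isInvertible_inChart hz.1)
      ((eventually_mem_transition hz.1 hz.2).mono fun w hw ↦
        bilinInChart_transition hw.1 hw.2 g))
  constructor
  · rw [bilinInChart_transition hy hx, accelInChart, hrel.1, hτ, ← covDeriv_eq_nab,
      bilinInChart_self]
    rfl
  · rw [hrel.2, ← ricciModel_eq_bochner Hp.smooth_metric.self_of_nhds Hp.symm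
      Hp.inv.self_of_nhds Hp.smooth_sharp.self_of_nhds, hτ, vfieldInChart_self]
    have : ∀ v : E, chartDeriv (E := E) p v = v := fun v ↦ by
      rw [chartDeriv_eq_id]
      rfl
    rw [ricciBar, ricci]
    exact congrArg₂ (ricciModel _ _) (this _) (this _)

end Manifold

section Manifold

variable {E : Type*} [NormedAddCommGroup E] [NormedSpace ℝ E]
  {M : Type*} [TopologicalSpace M] [ChartedSpace E M] [IsManifold 𝓘(ℝ, E) ∞ M]
  {g : Bilin E M} {ℓ : Form E M} {X : VField E M} {x₀ x : M} {y : E}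

/-! ### Lie derivatives in charts -/

theorem lieBilin_center (X : VField E M) (g : Bilin E M) (x : M) (u v : E) :
    bilinFun (lieBilin X g) x u v
      = lieBilinModel (vfieldInChart x X) (bilinInChart x g) (extChartAt 𝓘(ℝ, E) x x) u v := by
  have : ∀ v : E, chartDeriv (E := E) x v = v := fun v ↦ by
    rw [chartDeriv_eq_id]
    rfl
  exact congrArg₂ (fun a b : E ↦ lieBilinModel (vfieldInChart x X) (bilinInChart x g)
    (extChartAt 𝓘(ℝ, E) x x) a b) (this u) (this v)

theorem lieForm_center (X : VField E M) (ℓ : Form E M) (x : M) (u : E) :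
    formFun (lieForm X ℓ) x u
      = lieFormModel (vfieldInChart x X) (formInChart x ℓ) (extChartAt 𝓘(ℝ, E) x x) u := by
  have : ∀ v : E, chartDeriv (E := E) x v = v := fun v ↦ by
    rw [chartDeriv_eq_id]
    rfl
  exact congrArg (fun a : E ↦ lieFormModel (vfieldInChart x X) (formInChart x ℓ)
    (extChartAt 𝓘(ℝ, E) x x) a) (this u)

theorem formInChart_eq_center (ℓ : Form E M) (hy : y ∈ (extChartAt 𝓘(ℝ, E) x₀).target) {p : M}
    (hp : (extChartAt 𝓘(ℝ, E) x₀).symm y = p) (u : E) :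
    formInChart x₀ ℓ y u = formFun ℓ p (fderiv ℝ (transition x₀ p) y u) := by
  subst hp
  rw [formInChart_transition hy (mem_extChartAt_source _)]
  exact congrArg (fun T : E →L[ℝ] ℝ ↦ T _) (formInChart_self _ ℓ)

/-- Turns a pointwise equation for `L_X g`, stated in a different chart at each point, into an
equation on an open set of a single chart. -/
theorem lieBilinModel_inChart {U : Set M} (hU : IsOpen U) (hX : SmoothVFieldOn X U)
    (hg : SmoothBilin g) (hy : y ∈ (extChartAt 𝓘(ℝ, E) x₀).target)
    (hyU : (extChartAt 𝓘(ℝ, E) x₀).symm y ∈ U) {p : M}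
    (hp : (extChartAt 𝓘(ℝ, E) x₀).symm y = p) (u v : E) :
    lieBilinModel (vfieldInChart x₀ X) (bilinInChart x₀ g) y u v
      = bilinFun (lieBilin X g) p (fderiv ℝ (transition x₀ p) y u)
          (fderiv ℝ (transition x₀ p) y v) := by
  subst hp
  have hx := mem_extChartAt_source (I := 𝓘(ℝ, E)) ((extChartAt 𝓘(ℝ, E) x₀).symm y)
  rw [lieBilin_center]
  have ht := eventually_mem_transition hy hx
  exact related_lieBilinModel (contDiffAt_transition hy hx)
    (hg.contDiffAt (transition_mem hx)).differentiableAt_of_top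
    (hg.contDiffAt hy).differentiableAt_of_top
    (hX.contDiffAt hU (transition_mem hx)
      (by rwa [symm_transition hx])).differentiableAt_of_top
    (hX.contDiffAt hU hy hyU).differentiableAt_of_top
    (ht.mono fun z hz ↦ bilinInChart_transition hz.1 hz.2 g)
    (ht.mono fun z hz ↦ vfieldInChart_transition hz.1 hz.2 X) u v

theorem lieFormModel_inChart {U : Set M} (hU : IsOpen U) (hX : SmoothVFieldOn X U)
    (hℓ : SmoothForm ℓ) (hy : y ∈ (extChartAt 𝓘(ℝ, E) x₀).target)
    (hyU : (extChartAt 𝓘(ℝ, E) x₀).symm y ∈ U) {p : M}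
    (hp : (extChartAt 𝓘(ℝ, E) x₀).symm y = p) (u : E) :
    lieFormModel (vfieldInChart x₀ X) (formInChart x₀ ℓ) y u
      = formFun (lieForm X ℓ) p (fderiv ℝ (transition x₀ p) y u) := by
  subst hp
  have hx := mem_extChartAt_source (I := 𝓘(ℝ, E)) ((extChartAt 𝓘(ℝ, E) x₀).symm y)
  rw [lieForm_center]
  have ht := eventually_mem_transition hy hx
  exact related_lieFormModel (contDiffAt_transition hy hx)
    (hℓ.contDiffAt (transition_mem hx)).differentiableAt_of_top
    (hℓ.contDiffAt hy).differentiableAt_of_top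
    (hX.contDiffAt hU (transition_mem hx)
      (by rwa [symm_transition hx])).differentiableAt_of_top
    (hX.contDiffAt hU hy hyU).differentiableAt_of_top
    (ht.mono fun z hz ↦ formInChart_transition hz.1 hz.2 ℓ)
    (ht.mono fun z hz ↦ vfieldInChart_transition hz.1 hz.2 X) u

/-- The derivative of a function along a vector field. -/
noncomputable def lieScalar (X : VField E M) (f : M → ℝ) (x : M) : ℝ :=
  fderiv ℝ (fun z ↦ f ((extChartAt 𝓘(ℝ, E) x).symm z)) (extChartAt 𝓘(ℝ, E) x x)
    (vfieldInChart x X (extChartAt 𝓘(ℝ, E) x x))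

theorem fderiv_inChart_eq_lieScalar {f : M → ℝ} (hf : ContMDiff 𝓘(ℝ, E) 𝓘(ℝ, ℝ) ∞ f)
    (hy : y ∈ (extChartAt 𝓘(ℝ, E) x₀).target) :
    fderiv ℝ (fun z ↦ f ((extChartAt 𝓘(ℝ, E) x₀).symm z)) y (vfieldInChart x₀ X y)
      = lieScalar X f ((extChartAt 𝓘(ℝ, E) x₀).symm y) := by
  set p := (extChartAt 𝓘(ℝ, E) x₀).symm y with hp
  have hx : (extChartAt 𝓘(ℝ, E) x₀).symm y ∈ (extChartAt 𝓘(ℝ, E) p).source :=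
    mem_extChartAt_source p
  have h1 : (fun z ↦ f ((extChartAt 𝓘(ℝ, E) x₀).symm z)) =ᶠ[nhds y]
      (fun z ↦ f ((extChartAt 𝓘(ℝ, E) p).symm z)) ∘ transition x₀ p := by
    filter_upwards [eventually_mem_transition hy hx] with z hz
    rw [Function.comp_apply, symm_transition hz.2]
  have h2 : DifferentiableAt ℝ (fun z ↦ f ((extChartAt 𝓘(ℝ, E) p).symm z))
      (transition x₀ p y) :=
    (contDiffAt_comp_symm (mem_extChartAt_source p) (hf p)).differentiableAt_of_top
  rw [h1.fderiv_eq, fderiv_comp y h2 (contDiffAt_transition hy hx).differentiableAt_of_top,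
    ContinuousLinearMap.comp_apply, vfieldInChart_transition hy hx]
  rfl

/-- Makes the function `h` in the converse direction smooth. The chart in `lieScalar` varies with
the point, so it is first fixed by `fderiv_inChart_eq_lieScalar`. -/
theorem contMDiffOn_lieScalar {f : M → ℝ} (hf : ContMDiff 𝓘(ℝ, E) 𝓘(ℝ, ℝ) ∞ f) {U : Set M}
    (hU : IsOpen U) (hX : SmoothVFieldOn X U) :
    ContMDiffOn 𝓘(ℝ, E) 𝓘(ℝ, ℝ) ∞ (lieScalar X f) U := by
  intro x hxU
  refine ContMDiffAt.contMDiffWithinAt ?_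
  have hx := mem_extChartAt_source (I := 𝓘(ℝ, E)) x
  have h1 : ContDiffAt ℝ ∞ (fun y ↦ fderiv ℝ (fun z ↦ f ((extChartAt 𝓘(ℝ, E) x).symm z)) y
      (vfieldInChart x X y)) (extChartAt 𝓘(ℝ, E) x x) :=
    (contDiffAt_comp_symm hx (hf x)).fderiv_of_top.clm_apply
      (hX.contDiffAt hU (mem_extChartAt_target x) (by rwa [extChartAt_to_inv]))
  refine ((contMDiffAt_comp_extChartAt_iff hx).2 h1).congr_of_eventuallyEq ?_
  filter_upwards [(isOpen_extChartAt_source x).mem_nhds hx] with z hz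
  rw [fderiv_inChart_eq_lieScalar hf ((extChartAt 𝓘(ℝ, E) x).map_source hz),
    (extChartAt 𝓘(ℝ, E) x).left_inv hz]

variable [FiniteDimensional ℝ E]

/-! ### The metric `γ` -/

/-- The function `R̄ / a²`. -/
noncomputable def ratio (g : Bilin E M) (ℓ : Form E M) (x : M) : ℝ :=
  ricciBar g ℓ x / accelSq g ℓ x

omit [IsManifold 𝓘(ℝ, E) ∞ M] in
theorem gammaMetric_apply (g : Bilin E M) (ℓ : Form E M) (x : M)
    (u v : TangentSpace 𝓘(ℝ, E) x) :
    gammaMetric g ℓ x u v = g x u v + ratio g ℓ x * (ℓ x u * ℓ x v) := by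
  rw [← tensorSq_apply]
  rfl

omit [IsManifold 𝓘(ℝ, E) ∞ M] in
theorem bilinInChart_gammaMetric (g : Bilin E M) (ℓ : Form E M) (x₀ : M) (y : E) :
    bilinInChart x₀ (gammaMetric g ℓ) y = bilinInChart x₀ g y
      + ratio g ℓ ((extChartAt 𝓘(ℝ, E) x₀).symm y)
        • (formInChart x₀ ℓ y).smulRight (formInChart x₀ ℓ y) := by
  ext u v
  refine (gammaMetric_apply g ℓ _ _ _).trans ?_
  simp only [add_apply, smul_apply, ContinuousLinearMap.smulRight_apply, smul_eq_mul]
  rfl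

theorem ratio_inChart (hg : IsMetric g) (hℓ : SmoothForm ℓ) (hnull : IsNull g ℓ)
    (hy : y ∈ (extChartAt 𝓘(ℝ, E) x₀).target) :
    ratio g ℓ ((extChartAt 𝓘(ℝ, E) x₀).symm y)
      = bochner (christoffelL (bilinInChart x₀ g)) (vfieldInChart x₀ (sharp g ℓ)) y
        / bilinInChart x₀ g y (accelInChart g ℓ x₀ y) (accelInChart g ℓ x₀ y) := by
  rw [ratio, (accelSq_ricciBar_inChart hg hℓ hnull hy).1,
    (accelSq_ricciBar_inChart hg hℓ hnull hy).2]

theorem contMDiff_ratio (hg : IsMetric g) (hℓ : SmoothForm ℓ) (hnull : IsNull g ℓ)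
    (hng : IsNonGeodesic g ℓ) : ContMDiff 𝓘(ℝ, E) 𝓘(ℝ, ℝ) ∞ (ratio g ℓ) := by
  intro x
  have hx := mem_extChartAt_source (I := 𝓘(ℝ, E)) x
  have hy := mem_extChartAt_target (I := 𝓘(ℝ, E)) x
  have H := nullFormNear hg hℓ hnull hy
  have h0 := hng x
  have h1 := (accelSq_ricciBar_inChart hg hℓ hnull hy).1
  rw [extChartAt_to_inv] at h1
  rw [h1] at h0
  have h2 := (contDiffAt_bochner H.smooth_connection H.smooth_sharp.self_of_nhds).div
    ((H.smooth_metric.self_of_nhds.clm_apply H.smooth_accel).clm_apply H.smooth_accel) h0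
  refine ((contMDiffAt_comp_extChartAt_iff hx).2 h2).congr_of_eventuallyEq ?_
  filter_upwards [(isOpen_extChartAt_source x).mem_nhds hx] with z hz
  have h3 := ratio_inChart hg hℓ hnull ((extChartAt 𝓘(ℝ, E) x).map_source hz)
  rw [(extChartAt 𝓘(ℝ, E) x).left_inv hz] at h3
  exact h3

theorem IsNull.apply_sharp (hg : IsMetric g) (hnull : IsNull g ℓ) (x : M) :
    ℓ x (sharp g ℓ x) = 0 :=
  (hg.apply_sharp ℓ x _).symm.trans (hnull x)

theorem isMetric_gammaMetric (hg : IsMetric g) (hℓ : SmoothForm ℓ) (hnull : IsNull g ℓ)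
    (hng : IsNonGeodesic g ℓ) : IsMetric (gammaMetric g ℓ) where
  smooth x := by
    have hx := mem_extChartAt_source (I := 𝓘(ℝ, E)) x
    have hy := mem_extChartAt_target (I := 𝓘(ℝ, E)) x
    have hL := hℓ.contDiffAt hy
    refine (contMDiffAt_bilin_iff hx).2 ?_
    rw [funext (bilinInChart_gammaMetric g ℓ x)]
    exact (hg.smooth.contDiffAt hy).add
      ((contDiffAt_comp_symm hx (contMDiff_ratio hg hℓ hnull hng x)).smul (hL.smulRight hL))
  symm x u v := by
    rw [gammaMetric_apply, gammaMetric_apply, hg.symm, mul_comm (ℓ x u)]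
  nondegenerate x u hu := by
    have h0 : ℓ x (sharp g ℓ x) = 0 := hnull.apply_sharp hg x
    -- Testing against `S`, where `γ` and `g` agree because `ℓ(S) = 0`, gives `ℓ(u) = 0`; then `γ(u,
    -- ·) = g(u, ·)`.
    have h1 := hu (sharp g ℓ x)
    rw [gammaMetric_apply, h0, hg.symm, hg.apply_sharp] at h1
    refine hg.nondegenerate x u fun v ↦ ?_
    have h2 := hu v
    rw [gammaMetric_apply] at h2
    have h3 : ℓ x u = 0 := by linarith
    rw [h3] at h2
    linarith

/-- The map `P c : v ↦ v + c ℓ(v) S` changes `g(u, v)` by `2 c ℓ(u) ℓ(v)`, the quadratic term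
vanishing as `S` is null. With `c = -f / 2` this undoes the added multiple of `ℓ ⊗ ℓ`, so `P c` is
an isometry from `g` to `γ`, with inverse `P (-c)`. -/
theorem isLorentzian_gammaMetric (hg : IsMetric g) (hnull : IsNull g ℓ) (h : IsLorentzian g) :
    IsLorentzian (gammaMetric g ℓ) := by
  intro x
  obtain ⟨t, ht, hpos⟩ := h x
  have h0 : ℓ x (sharp g ℓ x) = 0 := hnull.apply_sharp hg x
  have hk : ∀ v, g x v (sharp g ℓ x) = ℓ x v := fun v ↦ by
    rw [hg.symm, hg.apply_sharp]
  let P : ℝ → TangentSpace 𝓘(ℝ, E) x → TangentSpace 𝓘(ℝ, E) x := fun c v ↦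
    v + (c * ℓ x v) • sharp g ℓ x
  have hℓP : ∀ c v, ℓ x (P c v) = ℓ x v := fun c v ↦ by
    simp [P, h0]
  have hP : ∀ u v, gammaMetric g ℓ x (P (-(ratio g ℓ x / 2)) u) (P (-(ratio g ℓ x / 2)) v)
      = g x u v := fun u v ↦ by
    rw [gammaMetric_apply, hℓP, hℓP]
    simp only [P, map_add, map_smul, add_apply, smul_apply, smul_eq_mul, hk, hg.apply_sharp, h0]
    ring
  have hinv : ∀ v, P (-(ratio g ℓ x / 2)) (P (ratio g ℓ x / 2) v) = v := fun v ↦ by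
    have h1 : P (-(ratio g ℓ x / 2)) (P (ratio g ℓ x / 2) v) = P (ratio g ℓ x / 2) v
      + (-(ratio g ℓ x / 2) * ℓ x (P (ratio g ℓ x / 2) v)) • sharp g ℓ x := rfl
    rw [h1, hℓP]
    simp only [P]
    module
  refine ⟨P (-(ratio g ℓ x / 2)) t, by rwa [hP], fun v hv hv0 ↦ ?_⟩
  rw [← hinv v, hP] at hv ⊢
  refine hpos _ hv fun h1 ↦ hv0 ?_
  rw [← hinv v, h1]
  simp [P]

/-- The Lie derivative of `γ`. -/
theorem lieBilin_gammaMetric (hg : IsMetric g) (hℓ : SmoothForm ℓ) (hnull : IsNull g ℓ)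
    (hng : IsNonGeodesic g ℓ) (X : VField E M) (x : M) (u v : E) :
    bilinFun (lieBilin X (gammaMetric g ℓ)) x u v = bilinFun (lieBilin X g) x u v
      + lieScalar X (ratio g ℓ) x * (formFun ℓ x u * formFun ℓ x v)
      + ratio g ℓ x * (formFun (lieForm X ℓ) x u * formFun ℓ x v
        + formFun ℓ x u * formFun (lieForm X ℓ) x v) := by
  have hy := mem_extChartAt_target (I := 𝓘(ℝ, E)) x
  rw [lieBilin_center, lieBilin_center, lieForm_center, lieForm_center,
    lieBilinModel_add_smul_sq (hg.smooth.contDiffAt hy).differentiableAt_of_top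
      (hℓ.contDiffAt hy).differentiableAt_of_top
      (contDiffAt_comp_symm (mem_extChartAt_source x)
        (contMDiff_ratio hg hℓ hnull hng x)).differentiableAt_of_top
      (Filter.Eventually.of_forall fun z ↦ bilinInChart_gammaMetric g ℓ x z),
    formInChart_self, extChartAt_to_inv]
  rfl

/-! ### Kerr-Schild vector fields and Killing vector fields -/

theorem kerrSchildNear (hg : IsMetric g) (hℓ : SmoothForm ℓ) (hnull : IsNull g ℓ) {U : Set M}
    (hU : IsOpen U) (hX : SmoothVFieldOn X U) {h m : M → ℝ}
    (hh : ContMDiffOn 𝓘(ℝ, E) 𝓘(ℝ, ℝ) ∞ h U) (hm : ContMDiffOn 𝓘(ℝ, E) 𝓘(ℝ, ℝ) ∞ m U)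
    (hlg : ∀ x ∈ U, lieBilin X g x = (2 * h x) • tensorSq ℓ x)
    (hlℓ : ∀ x ∈ U, lieForm X ℓ x = m x • ℓ x) (hx : x ∈ U) :
    KerrSchildNear (bilinInChart x g) (formInChart x ℓ) (vfieldInChart x (sharp g ℓ))
      (vfieldInChart x X) (fun z ↦ h ((extChartAt 𝓘(ℝ, E) x).symm z))
      (fun z ↦ m ((extChartAt 𝓘(ℝ, E) x).symm z)) (extChartAt 𝓘(ℝ, E) x x) := by
  have hy := mem_extChartAt_target (I := 𝓘(ℝ, E)) x
  have hn : ∀ᶠ z in nhds (extChartAt 𝓘(ℝ, E) x x), z ∈ (extChartAt 𝓘(ℝ, E) x).target ∧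
      (extChartAt 𝓘(ℝ, E) x).symm z ∈ U :=
    (eventually_mem_target hy).and ((contMDiffAt_extChartAt_symm hy).continuousAt.eventually
      (hU.mem_nhds (by rwa [extChartAt_to_inv])))
  have hs : ∀ f : M → ℝ, ContMDiffOn 𝓘(ℝ, E) 𝓘(ℝ, ℝ) ∞ f U → ∀ᶠ z in
      nhds (extChartAt 𝓘(ℝ, E) x x),
      ContDiffAt ℝ ∞ (fun z ↦ f ((extChartAt 𝓘(ℝ, E) x).symm z)) z := fun f hf ↦ by
    filter_upwards [hn] with z hz
    have h1 := contDiffAt_comp_symm ((extChartAt 𝓘(ℝ, E) x).map_target hz.1)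
      (hf.contMDiffAt (hU.mem_nhds hz.2))
    rwa [(extChartAt 𝓘(ℝ, E) x).right_inv hz.1] at h1
  refine ⟨nullFormNear hg hℓ hnull hy, hn.mono fun z hz ↦ hX.contDiffAt hU hz.1 hz.2, hs h hh,
    hs m hm, hn.mono fun z hz u v ↦ ?_, hn.mono fun z hz u ↦ ?_⟩
  · rw [lieBilinModel_inChart hU hX hg.smooth hz.1 hz.2 rfl,
      formInChart_eq_center ℓ hz.1 rfl, formInChart_eq_center ℓ hz.1 rfl]
    have h1 := hlg _ hz.2
    have h2 := congrArg (fun T : E →L[ℝ] E →L[ℝ] ℝ ↦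
      T (fderiv ℝ (transition x ((extChartAt 𝓘(ℝ, E) x).symm z)) z u)
        (fderiv ℝ (transition x ((extChartAt 𝓘(ℝ, E) x).symm z)) z v)) h1
    refine h2.trans ?_
    exact congrArg (_ * ·) (tensorSq_apply ℓ _ _ _)
  · rw [lieFormModel_inChart hU hX hℓ hz.1 hz.2 rfl, formInChart_eq_center ℓ hz.1 rfl]
    exact congrArg (fun T : E →L[ℝ] ℝ ↦
      T (fderiv ℝ (transition x ((extChartAt 𝓘(ℝ, E) x).symm z)) z u)) (hlℓ _ hz.2)

theorem lieScalar_ratio (hg : IsMetric g) (hℓ : SmoothForm ℓ) (hnull : IsNull g ℓ)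
    (hng : IsNonGeodesic g ℓ) {U : Set M}
    (hU : IsOpen U) (hX : SmoothVFieldOn X U) {h m : M → ℝ}
    (hh : ContMDiffOn 𝓘(ℝ, E) 𝓘(ℝ, ℝ) ∞ h U) (hm : ContMDiffOn 𝓘(ℝ, E) 𝓘(ℝ, ℝ) ∞ m U)
    (hlg : ∀ x ∈ U, lieBilin X g x = (2 * h x) • tensorSq ℓ x)
    (hlℓ : ∀ x ∈ U, lieForm X ℓ x = m x • ℓ x) (hx : x ∈ U) :
    lieScalar X (ratio g ℓ) x = -2 * m x * ratio g ℓ x - 2 * h x := by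
  have hy := mem_extChartAt_target (I := 𝓘(ℝ, E)) x
  have H := kerrSchildNear hg hℓ hnull hU hX hh hm hlg hlℓ hx
  have h1 := (accelSq_ricciBar_inChart hg hℓ hnull hy).1
  have h2 := ratio_inChart hg hℓ hnull hy
  have h0 := hng x
  rw [extChartAt_to_inv] at h1 h2
  rw [h1] at h0
  have h3 : (fun z ↦ ratio g ℓ ((extChartAt 𝓘(ℝ, E) x).symm z))
      =ᶠ[nhds (extChartAt 𝓘(ℝ, E) x x)] fun z ↦
        bochner (christoffelL (bilinInChart x g)) (vfieldInChart x (sharp g ℓ)) z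
        / bilinInChart x g z (accelInChart g ℓ x z) (accelInChart g ℓ x z) :=
    (eventually_mem_target hy).mono fun z hz ↦ ratio_inChart hg hℓ hnull hz
  rw [lieScalar, h3.fderiv_eq, h2]
  refine (H.fderiv_bochner_div_accelSq h0).trans ?_
  rw [extChartAt_to_inv]
  rfl

/-- The coefficient of `ℓ ⊗ ℓ` in `L_X γ` is `2 h + X(f) + 2 m f`, which is zero by
`lieScalar_ratio`. -/
theorem IsKerrSchildOn.isKillingOn (hg : IsMetric g) (hℓ : SmoothForm ℓ) (hnull : IsNull g ℓ)
    (hng : IsNonGeodesic g ℓ) {U : Set M} (hU : IsOpen U) (hX : IsKerrSchildOn g ℓ X U) :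
    IsKillingOn (gammaMetric g ℓ) X U := by
  obtain ⟨hs, ⟨h, hh, hlg⟩, m, hm, hlℓ⟩ := hX
  refine ⟨hs, fun x hx ↦ ?_⟩
  suffices key : ∀ u v : E, bilinFun (lieBilin X (gammaMetric g ℓ)) x u v = 0 from
    ContinuousLinearMap.ext fun u ↦ ContinuousLinearMap.ext fun v ↦ key u v
  intro u v
  rw [lieBilin_gammaMetric hg hℓ hnull hng]
  have h1 : bilinFun (lieBilin X g) x u v = 2 * h x * (formFun ℓ x u * formFun ℓ x v) :=
    (congrArg (fun T : E →L[ℝ] E →L[ℝ] ℝ ↦ T u v) (hlg x hx)).trans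
      (congrArg (_ * ·) (tensorSq_apply ℓ x u v))
  have h2 : ∀ w, formFun (lieForm X ℓ) x w = m x * formFun ℓ x w := fun w ↦
    congrArg (fun T : E →L[ℝ] ℝ ↦ T w) (hlℓ x hx)
  rw [h1, h2, h2, lieScalar_ratio hg hℓ hnull hng hU hs hh hm hlg hlℓ hx]
  ring

theorem IsKillingOn.isKerrSchildOn (hg : IsMetric g) (hℓ : SmoothForm ℓ) (hnull : IsNull g ℓ)
    (hng : IsNonGeodesic g ℓ) {U : Set M} (hU : IsOpen U)
    (hX : IsKillingOn (gammaMetric g ℓ) X U) (hd : PreservesDirectionOn ℓ X U) :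
    IsKerrSchildOn g ℓ X U := by
  refine ⟨hX.1, ?_, hd⟩
  obtain ⟨m, hm, hlℓ⟩ := hd
  have hr := contMDiff_ratio hg hℓ hnull hng
  -- The value of `h` obtained by solving `2 h + X(f) + 2 m f = 0`.
  refine ⟨fun x ↦ -(2⁻¹ * lieScalar X (ratio g ℓ) x + m x * ratio g ℓ x), ?_, fun x hx ↦ ?_⟩
  · exact ((contMDiffOn_const.mul (contMDiffOn_lieScalar hr hU hX.1)).add
      (hm.mul hr.contMDiffOn)).neg
  · suffices key : ∀ u v : E, bilinFun (lieBilin X g) x u v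
        = 2 * -(2⁻¹ * lieScalar X (ratio g ℓ) x + m x * ratio g ℓ x)
          * (formFun ℓ x u * formFun ℓ x v) from
      ContinuousLinearMap.ext fun u ↦ ContinuousLinearMap.ext fun v ↦
        (key u v).trans (congrArg (_ * ·) (tensorSq_apply ℓ x u v)).symm
    intro u v
    have h1 : bilinFun (lieBilin X (gammaMetric g ℓ)) x u v = 0 :=
      congrArg (fun T : E →L[ℝ] E →L[ℝ] ℝ ↦ T u v) (hX.2 x hx)
    have h2 : ∀ w, formFun (lieForm X ℓ) x w = m x * formFun ℓ x w := fun w ↦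
      congrArg (fun T : E →L[ℝ] ℝ ↦ T w) (hlℓ x hx)
    rw [lieBilin_gammaMetric hg hℓ hnull hng, h2, h2] at h1
    linarith

/-! ### Rescaling the null 1-form -/

omit [IsManifold 𝓘(ℝ, E) ∞ M] [FiniteDimensional ℝ E] in
theorem sharp_smul (g : Bilin E M) (ℓ : Form E M) (A : M → ℝ) (x : M) :
    sharp g (fun x ↦ A x • ℓ x) x = A x • sharp g ℓ x :=
  map_smul _ _ _

omit [IsManifold 𝓘(ℝ, E) ∞ M] in
theorem ricciBar_smul (g : Bilin E M) (ℓ : Form E M) (A : M → ℝ) (x : M) :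
    ricciBar g (fun x ↦ A x • ℓ x) x = A x ^ 2 * ricciBar g ℓ x := by
  rw [ricciBar, ricciBar, sharp_smul, ricci, map_smul, ricciModel_smul_smul]
  rfl

omit [IsManifold 𝓘(ℝ, E) ∞ M] [FiniteDimensional ℝ E] in
theorem IsNull.smul (hnull : IsNull g ℓ) (A : M → ℝ) : IsNull g (fun x ↦ A x • ℓ x) := fun x ↦ by
  rw [sharp_smul, map_smul, map_smul, smul_apply, hnull x]
  simp

/-- The acceleration of `A S` is `A² a + A S(A) S`, and the second term is null and orthogonal to
`a`. -/
theorem accelSq_smul (hg : IsMetric g) (hℓ : SmoothForm ℓ) (hnull : IsNull g ℓ) {A : M → ℝ}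
    (hA : ContMDiff 𝓘(ℝ, E) 𝓘(ℝ, ℝ) ∞ A) (x : M) :
    accelSq g (fun x ↦ A x • ℓ x) x = A x ^ 4 * accelSq g ℓ x := by
  have hy := mem_extChartAt_target (I := 𝓘(ℝ, E)) x
  have H := nullFormNear hg hℓ hnull hy
  have hS : vfieldInChart x (sharp g fun x ↦ A x • ℓ x)
      = fun z ↦ A ((extChartAt 𝓘(ℝ, E) x).symm z) • vfieldInChart x (sharp g ℓ) z := by
    funext z
    rw [vfieldInChart_eq, vfieldInChart_eq, ← map_smul]
    exact congrArg _ (sharp_smul g ℓ A _)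
  have h1 : ∀ ℓ' : Form E M, accelSq g ℓ' x
      = bilinInChart x g (extChartAt 𝓘(ℝ, E) x x)
        (accelInChart g ℓ' x (extChartAt 𝓘(ℝ, E) x x))
        (accelInChart g ℓ' x (extChartAt 𝓘(ℝ, E) x x)) := fun ℓ' ↦ by
    rw [bilinInChart_self, accelInChart, ← covDeriv_eq_nab]
    rfl
  have h2 : DifferentiableAt ℝ (fun z ↦ A ((extChartAt 𝓘(ℝ, E) x).symm z))
      (extChartAt 𝓘(ℝ, E) x x) :=
    (contDiffAt_comp_symm (mem_extChartAt_source x) (hA x)).differentiableAt_of_top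
  have hLA := H.form_nab (vfieldInChart x (sharp g ℓ) (extChartAt 𝓘(ℝ, E) x x))
  rw [h1, h1, accelInChart, accelInChart, hS, selfAccel, selfAccel,
    nab_smul h2 H.smooth_sharp.self_of_nhds.differentiableAt_of_top, extChartAt_to_inv]
  simp only [add_apply, smul_apply, ContinuousLinearMap.smulRight_apply, map_add, map_smul,
    smul_eq_mul, H.sharp_eq.self_of_nhds, H.bilin_sharp, H.null.self_of_nhds, hLA]
  ring

theorem gammaMetric_smul (hg : IsMetric g) (hℓ : SmoothForm ℓ) (hnull : IsNull g ℓ) {A : M → ℝ}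
    (hA : ContMDiff 𝓘(ℝ, E) 𝓘(ℝ, ℝ) ∞ A) (hA0 : ∀ x, A x ≠ 0) :
    gammaMetric g (fun x ↦ A x • ℓ x) = gammaMetric g ℓ := by
  funext x
  refine ContinuousLinearMap.ext fun u ↦ ContinuousLinearMap.ext fun v ↦ ?_
  rw [gammaMetric_apply, gammaMetric_apply, ratio, ratio, ricciBar_smul,
    accelSq_smul hg hℓ hnull hA]
  simp only [smul_apply, smul_eq_mul]
  have h0 := hA0 x
  congr 1
  -- Where `a² = 0`, both quotients are `0` by the convention on division by zero.
  by_cases ha : accelSq g ℓ x = 0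
  · simp [ha]
  · field_simp

end Manifold

end KerrSchild

theorem mainTheorem1
    {E : Type*} [NormedAddCommGroup E] [NormedSpace ℝ E] [FiniteDimensional ℝ E]
    {M : Type*} [TopologicalSpace M] [ChartedSpace E M] [IsManifold 𝓘(ℝ, E) ∞ M]
    (g : KerrSchild.Bilin E M) (hg : KerrSchild.IsMetric g)
    (ℓ : KerrSchild.Form E M) (hℓ : KerrSchild.SmoothForm ℓ)
    (hnull : KerrSchild.IsNull g ℓ) (hng : KerrSchild.IsNonGeodesic g ℓ) :
    KerrSchild.IsMetric (KerrSchild.gammaMetric g ℓ) ∧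
    (KerrSchild.IsLorentzian g → KerrSchild.IsLorentzian (KerrSchild.gammaMetric g ℓ)) ∧
    (∀ U : Set M, IsOpen U → ∀ ξ : KerrSchild.VField E M,
      KerrSchild.IsKerrSchildOn g ℓ ξ U ↔
        KerrSchild.IsKillingOn (KerrSchild.gammaMetric g ℓ) ξ U ∧
          KerrSchild.PreservesDirectionOn ℓ ξ U) ∧
    (∀ A : M → ℝ, ContMDiff 𝓘(ℝ, E) 𝓘(ℝ, ℝ) ∞ A → (∀ x, A x ≠ 0) →
      KerrSchild.IsNull g (fun x ↦ A x • ℓ x) ∧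
      KerrSchild.IsNonGeodesic g (fun x ↦ A x • ℓ x) ∧
      KerrSchild.gammaMetric g (fun x ↦ A x • ℓ x) = KerrSchild.gammaMetric g ℓ) := by
  refine ⟨KerrSchild.isMetric_gammaMetric hg hℓ hnull hng,
    KerrSchild.isLorentzian_gammaMetric hg hnull, fun U hU ξ ↦ ⟨fun h ↦
      ⟨h.isKillingOn hg hℓ hnull hng hU, h.2.2⟩, fun h ↦
      h.1.isKerrSchildOn hg hℓ hnull hng hU h.2⟩, fun A hA hA0 ↦
    ⟨hnull.smul A, fun x ↦ ?_, KerrSchild.gammaMetric_smul hg hℓ hnull hA hA0⟩⟩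
  rw [KerrSchild.accelSq_smul hg hℓ hnull hA]
  exact mul_ne_zero (pow_ne_zero _ (hA0 x)) (hng x)
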